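/- Let $\Sigma$ be a finite alphabet and $R$ an arbitrary set of weights. An $R$-weighted automaton $\mathcal A=(Q,\Sigma,\Delta,\mathrm{wgt})$ has a finite set $Q$ of states, transitions $\Delta\subseteq Q\times\Sigma\times Q$ and a weight map $\mathrm{wgt}\colon\Delta\to R$. A run from $p$ to $q$ is a sequence of consecutive transitions leading from $p$ to $q$ (the empty sequence is a run from $p$ to $p$ with the empty label), and $L(\mathcal A_{p,q})$ is the set of labels of runs from $p$ to $q$. For $u\in\Sigma^+$, $\{\!|\mathcal A_{p,q}|\!\}(u)$ is the multiset of the weight sequences $\mathrm{wgt}(\delta_1)\cdots\mathrm{wgt}(\delta_{|u|})$ of all runs $\delta_1\cdots\delta_{|u|}$ from $p$ to $q$ with label $u$; for sets $I,F\subseteq Q$ of initial and final states, $\{\!|\mathcal A|\!\}(u)=\biguplus_{p\in I,q\in F}\{\!|\mathcal A_{p,q}|\!\}(u)$. The automaton is aperiodic if there is $m\ge1$ such that $u^m\in L(\mathcal A_{p,q})\iff u^{m+1}\in L(\mathcal A_{p,q})$ for all $p,q\in Q$, $u\in\Sigma^+$. It is SCC-unambiguous if, for all $p,q$ in the same strongly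 connected component (i.e. $p=q$, or there are runs from $p$ to $q$ and from $q$ to $p$), every $u\in\Sigma^+$ labels at most one run from $p$ to $q$. Weighted first-order formulas ($\mathsf{wFO}$) over $\Sigma$ and $R$ are given by $$\varphi::=\top\mid P_a(x)\mid x\le y\mid\neg\varphi\mid\varphi\wedge\varphi\mid\forall x\,\varphi,\qquad \Psi::=r\mid\varphi\,?\,\Psi:\Psi,\qquad \Phi::=\mathbf 0\mid\textstyle\prod_x\Psi\mid\varphi\,?\,\Phi:\Phi\mid\Phi+\Phi\mid\sum_x\Phi$$ with $a\in\Sigma$, $r\in R$ and $x,y$ variables. Over a nonempty word $u$ with a valuation $\sigma$ of the variables by positions of $u$, the formulas $\varphi$ have the usual truth value, $\Psi$ denotes a single weight, and $\Phi$ denotes a finite multiset of weight sequences: $\mathbf 0$ denotes the empty multiset, $\prod_x\Psi$ the singleton consisting of the sequence $r_1\cdots r_{|u|}$, where $r_i$ is the value of $\Psi$ at $(u,\sigma[x\mapsto i])$, $+$ denotes multiset union, and $\sum_x\Phi$ the multiset union of the values of $\Phi$ at $(u,\sigma[x\mapsto i])$ over all positions $i$ of $u$. A sentence $\Phi$ (a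 formula without free variables) thus defines a map $\{\!|\Phi|\!\}$ from $\Sigma^+$ to finite multisets of weight sequences. Theorem. Let $\mathcal A$ be an aperiodic, SCC-unambiguous $R$-weighted automaton over $\Sigma$. For each pair of states $p,q$ one can construct a $\mathsf{wFO}$ sentence $\Phi_{p,q}$ with $\{\!|\mathcal A_{p,q}|\!\}=\{\!|\Phi_{p,q}|\!\}$. Moreover, for all sets $I,F$ of initial and final states, one can construct a $\mathsf{wFO}$ sentence $\Phi$ with $\{\!|\mathcal A|\!\}=\{\!|\Phi|\!\}$. Here "one can construct" means: the sentences exist, for an arbitrary set $R$; and if the elements of $\Sigma$ and $R$ are (primitive recursively) coded by natural numbers, then there are algorithms, depending only on $\Sigma$, $R$ and their codings, which compute (Gödel numbers of) $\Phi_{p,q}$ and $\Phi$ from a list of the weighted transitions of $\mathcal A$, whose states are $0,\dots,n-1$, together with $p,q$ or with lists of the elements of $I$ and $F$, respectively. -/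

import Mathlib

namespace WFOAut

/-- Nonempty words over `α`, i.e. the set `α⁺`. -/
abbrev NEWord (α : Type*) := {u : List α // u ≠ []}

/-- A weighted automaton `(Q, Σ, Δ, wgt)` with states `Q`, alphabet `α` and weights in an
arbitrary set `R`: a finite set of transitions, and a weight for each transition. -/
structure WAut (α R Q : Type*) where
  trans : Finset (Q × α × Q)
  wgt : {t : Q × α × Q // t ∈ trans} → R

namespace WAut

variable {α R Q : Type*}

/-- The type of transitions of `A`. -/
abbrev Tr (A : WAut α R Q) := {t : Q × α × Q // t ∈ A.trans}

/-- `A.IsRun p q ρ`: the sequence of transitions `ρ` is a run from `p` to `q`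
(the empty run being a run from `p` to `p`). -/
def IsRun (A : WAut α R Q) : Q → Q → List A.Tr → Prop
  | p, q, [] => p = q
  | p, q, δ :: ρ => δ.1.1 = p ∧ IsRun A δ.1.2.2 q ρ

/-- The word read by a sequence of transitions. -/
def label (A : WAut α R Q) (ρ : List A.Tr) : List α := ρ.map fun δ => δ.1.2.1

/-- The sequence of weights of a sequence of transitions. -/
def wgtSeq (A : WAut α R Q) (ρ : List A.Tr) : List R := ρ.map A.wgt

/-- The set of runs from `p` to `q` with label `u`. -/
def runs (A : WAut α R Q) (p q : Q) (u : List α) : Set (List A.Tr) :=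
  {ρ | A.IsRun p q ρ ∧ A.label ρ = u}

theorem runs_finite (A : WAut α R Q) (p q : Q) (u : List α) : (A.runs p q u).Finite :=
  (List.finite_length_eq A.Tr u.length).subset fun ρ h => by
    have h2 := congrArg List.length h.2
    simpa [label] using h2

/-- The language of labels of runs from `p` to `q` (with the empty word if `p = q`). -/
def lang (A : WAut α R Q) (p q : Q) : Set (List α) := {u | (A.runs p q u).Nonempty}

/-- The abstract semantics from `p` to `q`: a nonempty word `u` is sent to the multiset of weight
sequences of the runs from `p` to `q` with label `u`. -/
noncomputable def usem (A : WAut α R Q) (p q : Q) (u : NEWord α) : Multiset (List R) :=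
  (A.runs_finite p q u.1).toFinset.val.map A.wgtSeq

/-- The abstract semantics of `A` with initial states `I` and final states `F`. -/
noncomputable def usemAcc (A : WAut α R Q) (I F : Finset Q) (u : NEWord α) : Multiset (List R) :=
  ∑ p ∈ I, ∑ q ∈ F, A.usem p q u

/-- Aperiodicity: for some `m ≥ 1`, the words `u ^ m` and `u ^ (m + 1)` label runs between the same
pairs of states, for all nonempty words `u`. -/
def Aperiodic (A : WAut α R Q) : Prop :=
  ∃ m : ℕ, 1 ≤ m ∧ ∀ (p q : Q) (u : List α), u ≠ [] →
    ((List.replicate m u).flatten ∈ A.lang p q ↔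
      (List.replicate (m + 1) u).flatten ∈ A.lang p q)

/-- `p` and `q` are in the same strongly connected component. -/
def SameSCC (A : WAut α R Q) (p q : Q) : Prop :=
  p = q ∨ ((∃ ρ, A.IsRun p q ρ) ∧ ∃ ρ, A.IsRun q p ρ)

/-- `A` is unambiguous from `p` to `q`: every nonempty word labels at most one run. -/
def UnambiguousFrom (A : WAut α R Q) (p q : Q) : Prop :=
  ∀ u : List α, u ≠ [] → (A.runs p q u).Subsingleton

/-- `A` is unambiguous on each strongly connected component. -/
def SCCUnambiguous (A : WAut α R Q) : Prop :=
  ∀ p q : Q, A.SameSCC p q → A.UnambiguousFrom p q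

/-- The list `l` is a listing (in any order, possibly with repetitions) of the weighted transitions
`(p, a, q, wgt (p, a, q))` of an automaton with states `0, …, n - 1`. -/
def ListedBy {n : ℕ} (A : WAut α R (Fin n)) (l : List (ℕ × α × ℕ × R)) : Prop :=
  ∀ (x : ℕ) (a : α) (y : ℕ) (r : R), (x, a, y, r) ∈ l ↔
    ∃ (p q : Fin n) (h : (p, a, q) ∈ A.trans), (p : ℕ) = x ∧ (q : ℕ) = y ∧ A.wgt ⟨(p, a, q), h⟩ = r

end WAut

/-- Boolean first-order formulas over words; the variables are the natural numbers. -/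
inductive FO (α : Type*) where
  | top : FO α
  | letter (a : α) (x : ℕ) : FO α
  | le (x y : ℕ) : FO α
  | neg (φ : FO α) : FO α
  | and (φ ψ : FO α) : FO α
  | all (x : ℕ) (φ : FO α) : FO α

/-- Step formulas: constants and if-then-else. -/
inductive StepFO (α R : Type*) where
  | const (r : R) : StepFO α R
  | ite (φ : FO α) (Ψ₁ Ψ₂ : StepFO α R) : StepFO α R

/-- Weighted first-order formulas. -/
inductive WFO (α R : Type*) where
  | zero : WFO α R
  | prod (x : ℕ) (Ψ : StepFO α R) : WFO α R
  | ite (φ : FO α) (Φ₁ Φ₂ : WFO α R) : WFO α R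
  | add (Φ₁ Φ₂ : WFO α R) : WFO α R
  | sum (x : ℕ) (Φ : WFO α R) : WFO α R

namespace FO

variable {α : Type*}

/-- `u, σ ⊨ φ`. Positions of `u` are numbered from `0`. -/
def Sat (u : List α) : (ℕ → Fin u.length) → FO α → Prop
  | _, top => True
  | σ, letter a x => u.get (σ x) = a
  | σ, le x y => σ x ≤ σ y
  | σ, neg φ => ¬ Sat u σ φ
  | σ, and φ ψ => Sat u σ φ ∧ Sat u σ ψ
  | σ, all x φ => ∀ i : Fin u.length, Sat u (Function.update σ x i) φ

/-- Free variables. -/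
def fv : FO α → Set ℕ
  | top => ∅
  | letter _ x => {x}
  | le x y => {x, y}
  | neg φ => fv φ
  | and φ ψ => fv φ ∪ fv ψ
  | all x φ => fv φ \ {x}

/-- Gödel number of a formula. -/
def code [Encodable α] : FO α → ℕ
  | top => Nat.pair 0 0
  | letter a x => Nat.pair 1 (Nat.pair (Encodable.encode a) x)
  | le x y => Nat.pair 2 (Nat.pair x y)
  | neg φ => Nat.pair 3 (code φ)
  | and φ ψ => Nat.pair 4 (Nat.pair (code φ) (code ψ))
  | all x φ => Nat.pair 5 (Nat.pair x (code φ))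

end FO

namespace StepFO

variable {α R : Type*}

open Classical in
/-- The semantics of a step formula is a single weight. -/
noncomputable def sem (u : List α) (σ : ℕ → Fin u.length) : StepFO α R → R
  | const r => r
  | ite φ Ψ₁ Ψ₂ => if FO.Sat u σ φ then sem u σ Ψ₁ else sem u σ Ψ₂

/-- Free variables. -/
def fv : StepFO α R → Set ℕ
  | const _ => ∅
  | ite φ Ψ₁ Ψ₂ => φ.fv ∪ fv Ψ₁ ∪ fv Ψ₂

/-- Gödel number of a step formula. -/
def code [Encodable α] [Encodable R] : StepFO α R → ℕ
  | const r => Nat.pair 0 (Encodable.encode r)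
  | ite φ Ψ₁ Ψ₂ => Nat.pair 1 (Nat.pair φ.code (Nat.pair (code Ψ₁) (code Ψ₂)))

end StepFO

namespace WFO

variable {α R : Type*}

open Classical in
/-- The semantics of a weighted formula is a multiset of weight sequences. -/
noncomputable def sem (u : List α) : (ℕ → Fin u.length) → WFO α R → Multiset (List R)
  | _, zero => 0
  | σ, prod x Ψ => {List.ofFn fun i : Fin u.length => Ψ.sem u (Function.update σ x i)}
  | σ, ite φ Φ₁ Φ₂ => if FO.Sat u σ φ then sem u σ Φ₁ else sem u σ Φ₂
  | σ, add Φ₁ Φ₂ => sem u σ Φ₁ + sem u σ Φ₂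
  | σ, sum x Φ => ∑ i : Fin u.length, sem u (Function.update σ x i) Φ

/-- Free variables. -/
def fv : WFO α R → Set ℕ
  | zero => ∅
  | prod x Ψ => Ψ.fv \ {x}
  | ite φ Φ₁ Φ₂ => φ.fv ∪ fv Φ₁ ∪ fv Φ₂
  | add Φ₁ Φ₂ => fv Φ₁ ∪ fv Φ₂
  | sum x Φ => fv Φ \ {x}

/-- A sentence is a formula without free variables. -/
def IsSentence (Φ : WFO α R) : Prop := Φ.fv = ∅

/-- The abstract semantics of a sentence. As there are no free variables, the choice of the
valuation (here: every variable at the first position) does not matter. -/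
noncomputable def usem (Φ : WFO α R) (u : NEWord α) : Multiset (List R) :=
  Φ.sem u.1 fun _ => ⟨0, List.length_pos_of_ne_nil u.2⟩

/-- Gödel number of a weighted formula. -/
def code [Encodable α] [Encodable R] : WFO α R → ℕ
  | zero => Nat.pair 0 0
  | prod x Ψ => Nat.pair 1 (Nat.pair x Ψ.code)
  | ite φ Φ₁ Φ₂ => Nat.pair 2 (Nat.pair φ.code (Nat.pair (code Φ₁) (code Φ₂)))
  | add Φ₁ Φ₂ => Nat.pair 3 (Nat.pair (code Φ₁) (code Φ₂))
  | sum x Φ => Nat.pair 4 (Nat.pair x (code Φ))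

end WFO

end WFOAut

namespace WFOAut

/-! A run is determined by its label, its end points and a bounded amount of data. Let the `height`
of a state be the number of transitions whose source it cannot reach. Heights grow weakly along a
run, and strictly when the strongly connected component changes. For each level `i` below the number
of transitions, a nonempty run has exactly one canonical position (`Canon`): the first transition
whose target has height greater than `i`, or the last transition if there is none. All changes of
component happen at canonical positions, and between them unambiguity leaves no choice
(`IsHeight.match_unique`). Conversely a run determines its canonical positions `t` and the
transitions `e` there (`IsHeight.match_positions_unique`). So the runs from `p` to `q` on `u`
correspond to those pairs `(t, e)` that some run matches. The sentence is a finite sum over `e` and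
a sum over the positions `t`. If a run matches `(t, e)`, the body is a product over `x` of the
weight at `x`, found by asking for each transition whether a run matching `(t, e)` uses it at `x`.

It remains to express by a first-order formula that a run with prescribed transitions at given
positions exists. Letters and single transitions act on sets of states, and aperiodicity makes the
generated transformations counter-free (`counterFree_actions`). By `ev_eq_of_EF`, a quantitative
form of the theorem that aperiodic languages are first-order definable, a product of such actions is
invariant under Ehrenfeucht–Fraïssé equivalence of an explicit rank. Hence the existence of the run
depends only on the type of the word with its distinguished positions (`exists_run_of_WEF`), and it
is expressed by a disjunction of Hintikka formulas (`sat_runFormula`).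

For computability, `exists_short_WEF` bounds explicitly the length of a representative of each type,
so the disjunction can be found by searching through short sequences of transitions. The Gödel
numbers of all the formulas are then primitive recursive in the list of transitions. -/

/-! ### Ehrenfeucht–Fraïssé equivalence of labelled sets of positions -/

section EF

variable {A B : Type*}

/-- The pairs in `s` form a partial isomorphism for the labels and the order. -/
def PIso (l l' : ℕ → A) (s : Set (ℕ × ℕ)) : Prop :=
  ∀ p ∈ s, l p.1 = l' p.2 ∧ ∀ q ∈ s, (p.1 ≤ q.1 ↔ p.2 ≤ q.2)

/-- The duplicator wins the `k`-round game on the labelled sets of positions `(P, l)` and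
`(P', l')`, when the pairs in `s` have been chosen already. -/
def EF (P : Set ℕ) (l : ℕ → A) (P' : Set ℕ) (l' : ℕ → A) : ℕ → Set (ℕ × ℕ) → Prop
  | 0, s => PIso l l' s
  | k + 1, s => PIso l l' s ∧ (∀ x ∈ P, ∃ y ∈ P', EF P l P' l' k (insert (x, y) s)) ∧
      ∀ y ∈ P', ∃ x ∈ P, EF P l P' l' k (insert (x, y) s)

theorem PIso.anti {l l' : ℕ → A} {s t : Set (ℕ × ℕ)} (h : PIso l l' t) (hst : s ⊆ t) :
    PIso l l' s :=
  fun p hp => ⟨(h p (hst hp)).1, fun q hq => (h p (hst hp)).2 q (hst hq)⟩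

theorem PIso.symm {l l' : ℕ → A} {s : Set (ℕ × ℕ)} (h : PIso l l' s) :
    PIso l' l (Prod.swap ⁻¹' s) :=
  fun p hp => ⟨((h p.swap hp).1).symm, fun q hq => ((h p.swap hp).2 q.swap hq).symm⟩

variable {P P' P'' : Set ℕ} {l l' l'' : ℕ → A} {k m : ℕ} {s t : Set (ℕ × ℕ)}

theorem EF.piso (h : EF P l P' l' k s) : PIso l l' s := by
  cases k with
  | zero => exact h
  | succ k => exact h.1

theorem EF.anti (h : EF P l P' l' k t) (hst : s ⊆ t) : EF P l P' l' k s := by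
  induction k generalizing s t with
  | zero => exact PIso.anti h hst
  | succ k ih =>
    refine ⟨h.1.anti hst, fun x hx => ?_, fun y hy => ?_⟩
    · obtain ⟨y, hy, h'⟩ := h.2.1 x hx
      exact ⟨y, hy, ih h' (Set.insert_subset_insert hst)⟩
    · obtain ⟨x, hx, h'⟩ := h.2.2 y hy
      exact ⟨x, hx, ih h' (Set.insert_subset_insert hst)⟩

theorem EF.of_succ (h : EF P l P' l' (k + 1) s) : EF P l P' l' k s := by
  induction k generalizing s with
  | zero => exact h.piso
  | succ k ih =>
    refine ⟨h.1, fun x hx => ?_, fun y hy => ?_⟩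
    · obtain ⟨y, hy, h'⟩ := h.2.1 x hx
      exact ⟨y, hy, ih h'⟩
    · obtain ⟨x, hx, h'⟩ := h.2.2 y hy
      exact ⟨x, hx, ih h'⟩

theorem EF.of_le (h : EF P l P' l' m s) (hk : k ≤ m) : EF P l P' l' k s := by
  induction hk with
  | refl => exact h
  | step _ ih => exact ih h.of_succ

theorem EF.symm (h : EF P l P' l' k s) : EF P' l' P l k (Prod.swap ⁻¹' s) := by
  have key : ∀ x y (s : Set (ℕ × ℕ)),
      (Prod.swap ⁻¹' insert (x, y) s : Set (ℕ × ℕ)) = insert (y, x) (Prod.swap ⁻¹' s) := by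
    intro x y s; ext ⟨a, b⟩; simp [and_comm]
  induction k generalizing s with
  | zero => exact PIso.symm h
  | succ k ih =>
    refine ⟨h.1.symm, fun y hy => ?_, fun x hx => ?_⟩
    · obtain ⟨x, hx, h'⟩ := h.2.2 y hy
      exact ⟨x, hx, key x y s ▸ ih h'⟩
    · obtain ⟨y, hy, h'⟩ := h.2.1 x hx
      exact ⟨y, hy, key x y s ▸ ih h'⟩

/-- The duplicator answers through the middle structure. The composite of the two enlarged relations
may contain more than the new pair, and `EF.anti` discards the surplus. -/
theorem EF.trans (h : EF P l P' l' k s) (h' : EF P' l' P'' l'' k t) :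
    EF P l P'' l'' k {p | ∃ y, (p.1, y) ∈ s ∧ (y, p.2) ∈ t} := by
  have base : ∀ {s t : Set (ℕ × ℕ)}, PIso l l' s → PIso l' l'' t →
      PIso l l'' {p | ∃ y, (p.1, y) ∈ s ∧ (y, p.2) ∈ t} := by
    rintro s t h h' ⟨x, z⟩ ⟨y, hxy, hyz⟩
    refine ⟨(h _ hxy).1.trans (h' _ hyz).1, ?_⟩
    rintro ⟨x', z'⟩ ⟨y', hxy', hyz'⟩
    exact ((h _ hxy).2 _ hxy').trans ((h' _ hyz).2 _ hyz')
  have key : ∀ (x y z : ℕ) (s t : Set (ℕ × ℕ)),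
      insert (x, z) {p : ℕ × ℕ | ∃ y, (p.1, y) ∈ s ∧ (y, p.2) ∈ t} ⊆
      {p : ℕ × ℕ | ∃ y', (p.1, y') ∈ insert (x, y) s ∧ (y', p.2) ∈ insert (y, z) t} := by
    rintro x y z s t p (rfl | ⟨w, hw, hw'⟩)
    · exact ⟨y, Or.inl rfl, Or.inl rfl⟩
    · exact ⟨w, Or.inr hw, Or.inr hw'⟩
  induction k generalizing s t with
  | zero => exact base h h'
  | succ k ih =>
    refine ⟨base h.1 h'.1, fun x hx => ?_, fun z hz => ?_⟩
    · obtain ⟨y, hy, h1⟩ := h.2.1 x hx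
      obtain ⟨z, hz, h2⟩ := h'.2.1 y hy
      exact ⟨z, hz, (ih h1 h2).anti (key x y z s t)⟩
    · obtain ⟨y, hy, h2⟩ := h'.2.2 z hz
      obtain ⟨x, hx, h1⟩ := h.2.2 y hy
      exact ⟨x, hx, (ih h1 h2).anti (key x y z s t)⟩

/-- Interpretations: if membership in `C ⊆ P` and the labels `m` on `C` are determined by `r`
rounds of the game, then the game may be restricted to `C` and relabelled by `m`. -/
theorem EF.interp {C C' : Set ℕ} {m m' : ℕ → B} {r : ℕ} (hC : C ⊆ P) (hC' : C' ⊆ P')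
    (hs : EF P l P' l' (k + r) s)
    (H : ∀ s₁ ⊇ s, EF P l P' l' r s₁ → ∀ x ∈ P, ∀ y ∈ P', (x, y) ∈ s₁ →
      (x ∈ C ↔ y ∈ C') ∧ (x ∈ C → y ∈ C' → m x = m' y))
    (ht : t ⊆ s) (htC : ∀ p ∈ t, p.1 ∈ C ∧ p.2 ∈ C') : EF C m C' m' k t := by
  have base : ∀ {k s t}, EF P l P' l' (k + r) s →
      (∀ s₁ ⊇ s, EF P l P' l' r s₁ → ∀ x ∈ P, ∀ y ∈ P', (x, y) ∈ s₁ →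
      (x ∈ C ↔ y ∈ C') ∧ (x ∈ C → y ∈ C' → m x = m' y)) → t ⊆ s →
      (∀ p ∈ t, p.1 ∈ C ∧ p.2 ∈ C') → PIso m m' t := by
    intro k s t hs H ht htC p hp
    refine ⟨?_, ((hs.piso.anti ht) p hp).2⟩
    obtain ⟨h1, h2⟩ := htC p hp
    exact (H s subset_rfl (hs.of_le (by omega)) _ (hC h1) _ (hC' h2) (ht hp)).2 h1 h2
  induction k generalizing s t with
  | zero => exact base hs H ht htC
  | succ k ih =>
    rw [show k + 1 + r = (k + r) + 1 by omega] at hs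
    refine ⟨base (k := k) hs.of_succ H ht htC, fun x hx => ?_, fun y hy => ?_⟩
    · obtain ⟨y, hy, h'⟩ := hs.2.1 x (hC hx)
      have hyC := (H _ (Set.subset_insert _ _) (h'.of_le (by omega)) x (hC hx) y hy
        (Set.mem_insert _ _)).1.1 hx
      refine ⟨y, hyC, ih h' (fun s₁ h1 => H s₁ ((Set.subset_insert _ _).trans h1))
        (Set.insert_subset_insert ht) ?_⟩
      rintro p (rfl | hp)
      exacts [⟨hx, hyC⟩, htC p hp]
    · obtain ⟨x, hx, h'⟩ := hs.2.2 y (hC' hy)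
      have hxC := (H _ (Set.subset_insert _ _) (h'.of_le (by omega)) x hx y (hC' hy)
        (Set.mem_insert _ _)).1.2 hy
      refine ⟨x, hxC, ih h' (fun s₁ h1 => H s₁ ((Set.subset_insert _ _).trans h1))
        (Set.insert_subset_insert ht) ?_⟩
      rintro p (rfl | hp)
      exacts [⟨hxC, hy⟩, htC p hp]

theorem PIso.lt_iff (h : PIso l l' s) {p q : ℕ × ℕ} (hp : p ∈ s) (hq : q ∈ s) :
    p.1 < q.1 ↔ p.2 < q.2 := by
  have := (h q hq).2 p hp
  omega

theorem PIso.eq_iff (h : PIso l l' s) {p q : ℕ × ℕ} (hp : p ∈ s) (hq : q ∈ s) :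
    p.1 = q.1 ↔ p.2 = q.2 := by
  have := (h q hq).2 p hp
  have := (h p hp).2 q hq
  omega

end EF

/-! ### Evaluation of labelled sets of positions, and counter-free transformations -/

section Eval

variable {Q : Type*}

open Classical in
/-- The labels of the positions in `P` below `n`, applied in increasing order. -/
noncomputable def ev (P : Set ℕ) (l : ℕ → Q → Q) : ℕ → Q → Q
  | 0, q => q
  | n + 1, q => if n ∈ P then l n (ev P l n q) else ev P l n q

variable {P F : Set ℕ} {l : ℕ → Q → Q} {a b n : ℕ} {q : Q}

theorem ev_succ_of_mem (h : n ∈ P) : ev P l (n + 1) q = l n (ev P l n q) := by simp [ev, h]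

theorem ev_succ_of_notMem (h : n ∉ P) : ev P l (n + 1) q = ev P l n q := by simp [ev, h]

theorem ev_eq_of_forall_notMem (hab : a ≤ b) (h : ∀ x, a ≤ x → x < b → x ∉ P) :
    ev P l b q = ev P l a q := by
  induction b, hab using Nat.le_induction with
  | base => rfl
  | succ b hab ih =>
    rw [ev_succ_of_notMem (h b hab (by omega)), ih fun x h1 h2 => h x h1 (by omega)]

/-- `F` contributes nothing before `a` and agrees with `P` from there up to `b`, so it can take over
from `P` at `a`. -/
theorem ev_ev (hab : a ≤ b) (h : ∀ x, a ≤ x → x < b → (x ∈ F ↔ x ∈ P))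
    (hF : ∀ x ∈ F, a ≤ x) : ev F l b (ev P l a q) = ev P l b q := by
  induction b, hab using Nat.le_induction with
  | base =>
    rw [ev_eq_of_forall_notMem (Nat.zero_le a) fun x _ h2 h3 => absurd (hF x h3) (by omega)]
    rfl
  | succ b hab ih =>
    specialize ih fun x h1 h2 => h x h1 (by omega)
    by_cases hb : b ∈ P
    · rw [ev_succ_of_mem hb, ev_succ_of_mem ((h b hab (by omega)).2 hb), ih]
    · rw [ev_succ_of_notMem hb, ev_succ_of_notMem (mt (h b hab (by omega)).1 hb), ih]

/-! ### Counter-free sets of transformations -/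

/-- The transformations generated by `B`. -/
inductive Gen (B : Set (Q → Q)) : (Q → Q) → Prop
  | id : Gen B id
  | comp {f g : Q → Q} : f ∈ B → Gen B g → Gen B (f ∘ g)

theorem Gen.of_mem {B : Set (Q → Q)} {f : Q → Q} (hf : f ∈ B) : Gen B f := Gen.comp hf Gen.id

theorem Gen.comp_gen {B : Set (Q → Q)} {f g : Q → Q} (hf : Gen B f) (hg : Gen B g) :
    Gen B (f ∘ g) := by
  induction hf with
  | id => exact hg
  | @comp f f' h _ ih => exact (Gen.comp h ih : Gen B (f ∘ (f' ∘ g)))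

theorem Gen.mono {B B' : Set (Q → Q)} (h : B ⊆ B') {f : Q → Q} (hf : Gen B f) : Gen B' f := by
  induction hf with
  | id => exact Gen.id
  | comp h' _ ih => exact Gen.comp (h h') ih

theorem Gen.ev {B : Set (Q → Q)} (h : ∀ x ∈ P, l x ∈ B) (n : ℕ) : Gen B (ev P l n) := by
  induction n with
  | zero => exact Gen.id
  | succ n ih =>
    by_cases hn : n ∈ P
    · have : WFOAut.ev P l (n + 1) = l n ∘ WFOAut.ev P l n := funext fun q => ev_succ_of_mem hn
      exact this ▸ Gen.comp (h n hn) ih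
    · have : WFOAut.ev P l (n + 1) = WFOAut.ev P l n := funext fun q => ev_succ_of_notMem hn
      exact this ▸ ih

/-- No transformation generated by `B` has a nontrivial cycle. -/
def CounterFree (B : Set (Q → Q)) : Prop :=
  ∀ g, Gen B g → ∀ q, ∃ m, g^[m] q = g^[m + 1] q

/-- Injectivity allows `f^[m]` to be cancelled from `f^[m] q = f^[m + 1] q`. -/
theorem CounterFree.eq_of_injective {B : Set (Q → Q)} (hB : CounterFree B) {f : Q → Q}
    (hf : f ∈ B) (hi : Function.Injective f) (q : Q) : f q = q := by
  obtain ⟨m, hm⟩ := hB f (Gen.of_mem hf) q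
  exact ((hi.iterate m) (by simpa using hm)).symm

/-! Splitting at the positions labelled by a fixed transformation `c`. -/

/-- The positions before all those in `C`. -/
def headSeg (P C : Set ℕ) : Set ℕ := {z ∈ P | ∀ w ∈ C, z < w}

/-- The positions after all those in `C`. -/
def tailSeg (P C : Set ℕ) : Set ℕ := {z ∈ P | ∀ w ∈ C, w < z}

/-- The positions between `x` and the next position in `C`. -/
def nextSeg (P C : Set ℕ) (x : ℕ) : Set ℕ := {z ∈ P | x < z ∧ ∀ w ∈ C, x < w → z < w}

/-- The positions in `C` except for the last one. -/
def notLast (C : Set ℕ) : Set ℕ := {x ∈ C | ∃ w ∈ C, x < w}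

/-- The transformation of the range of `c` that is given by a segment followed by `c`. -/
noncomputable def blockMap (c : Q → Q) (P C : Set ℕ) (l : ℕ → Q → Q) (n x : ℕ)
    (y : Set.range c) : Set.range c :=
  ⟨c (ev (nextSeg P C x) l n y.1), _, rfl⟩

/-- Cut `P` at the positions of `C`: a head, then `c`, then for every position of `C` except the
last one the block made of the following segment and the next `c`, then a tail. After each `c` the
state lies in the range of `c`, so the blocks act on that set, which is smaller than `Q` when `c` is
not injective and `Q` is finite. -/
theorem ev_blocks (c : Q → Q) {C : Set ℕ} (hC : C ⊆ P) (hl : ∀ x ∈ C, l x = c)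
    (hn : ∀ x ∈ P, x < n) (hne : C.Nonempty) (q : Q) :
    ev P l n q = ev (tailSeg P C) l n
      (ev (notLast C) (blockMap c P C l n) n ⟨c (ev (headSeg P C) l n q), _, rfl⟩).1 := by
  set y₀ : Set.range c := ⟨c (ev (headSeg P C) l n q), _, rfl⟩ with hy₀
  -- A block already includes the `c` at the next position of `C`. So the blocks strictly below `x`,
  -- started after the first `c`, account for `P` up to and including `x`.
  have key : ∀ x ∈ C, (ev (notLast C) (blockMap c P C l n) x y₀).1 = ev P l (x + 1) q := by
    intro x
    induction x using Nat.strong_induction_on with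
    | _ x ih =>
      intro hx
      by_cases h0 : ∃ w ∈ C, w < x
      · obtain ⟨w, ⟨hwC, hwx⟩, hmax⟩ : ∃ w ∈ {w ∈ C | w < x}, ∀ w' ∈ {w ∈ C | w < x}, w' ≤ w := by
          have hfin : {w ∈ C | w < x}.Finite := (Set.finite_lt_nat x).subset fun w hw => hw.2
          obtain ⟨w, hw⟩ := hfin.exists_maximal h0
          exact ⟨w, hw.1, fun w' hw' => (le_total w' w).elim id fun h => hw.2 hw' h⟩
        have hgap : ∀ z ∈ C, w < z → x ≤ z := by
          intro z hz hwz
          by_contra hzx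
          exact absurd (hmax z ⟨hz, by omega⟩) (by omega)
        rw [ev_eq_of_forall_notMem (a := w + 1) (by omega)
          fun z h1 h2 h3 => absurd (hgap z h3.1 (by omega)) (by omega),
          ev_succ_of_mem (show w ∈ notLast C from ⟨hwC, x, hx, hwx⟩)]
        change c (ev (nextSeg P C w) l n (ev (notLast C) (blockMap c P C l n) w y₀).1) = _
        rw [ih w hwx hwC, ev_succ_of_mem (hC hx), hl x hx,
          ev_eq_of_forall_notMem (a := x) (hn x (hC hx)).le
            fun z h1 _ h3 => absurd (h3.2.2 x hx hwx) (by omega)]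
        congr 1
        refine ev_ev (by omega) (fun z h1 h2 => ⟨fun h => h.1, fun h => ⟨h, by omega, ?_⟩⟩)
          fun z h => h.2.1
        intro w' hw' hww'
        exact h2.trans_le (hgap w' hw' hww')
      · push Not at h0
        rw [ev_eq_of_forall_notMem (Nat.zero_le x)
          fun z _ h2 h3 => absurd (h0 z h3.1) (by omega)]
        change c (ev (headSeg P C) l n q) = _
        rw [ev_succ_of_mem (hC hx), hl x hx, ev_eq_of_forall_notMem (a := x) (hn x (hC hx)).le
            fun z h1 _ h3 => absurd (h3.2 x hx) (by omega)]
        congr 1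
        exact ev_ev (P := P) (a := 0) (q := q) (Nat.zero_le x) (fun z _ h2 => ⟨fun h => h.1,
          fun h => ⟨h, fun w hw => h2.trans_le (h0 w hw)⟩⟩) fun z _ => Nat.zero_le z
  obtain ⟨x, hxC, hmax⟩ : ∃ x ∈ C, ∀ w ∈ C, w ≤ x := by
    have hfin : C.Finite := (Set.finite_lt_nat n).subset fun w hw => hn w (hC hw)
    obtain ⟨w, hw⟩ := hfin.exists_maximal hne
    exact ⟨w, hw.1, fun w' hw' => (le_total w' w).elim id fun h => hw.2 hw' h⟩
  have hxn := hn x (hC hxC)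
  have hlast : ∀ z, x ≤ z → z < n → z ∉ notLast C := by
    rintro z h1 _ ⟨h3, w, hw, h4⟩
    exact absurd (hmax w hw) (by omega)
  rw [ev_eq_of_forall_notMem hxn.le hlast, key x hxC]
  symm
  apply ev_ev (by omega)
  · intro z h1 _
    exact ⟨fun h => h.1, fun h => ⟨h, fun w hw => (hmax w hw).trans_lt h1⟩⟩
  · exact fun z h => h.2 x hxC

/-- The number of rounds that suffices for counter-free transformations of an `n`-element set. -/
def cfRank : ℕ → ℕ
  | 0 => 0
  | n + 1 => (n + 1) ^ (n + 1) * (cfRank n + 1)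

theorem pow_self_le {m n : ℕ} (h : m ≤ n) : m ^ m ≤ n ^ n := by
  rcases Nat.eq_zero_or_pos n with rfl | hn
  · obtain rfl : m = 0 := by omega
    rfl
  · exact (Nat.pow_le_pow_left h m).trans (Nat.pow_le_pow_right hn h)

/-- Aperiodic transformations are determined by first-order properties: the evaluation of a
labelled set of positions, with labels from a counter-free set of transformations, is invariant
under equivalence of rank `cfRank n`. -/
theorem ev_eq_of_EF : ∀ (n : ℕ) {Q : Type*} [Finite Q] (B : Set (Q → Q)), Nat.card Q ≤ n →
    CounterFree B → ∀ {P P' : Set ℕ} {l l' : ℕ → Q → Q} {N N' : ℕ}, (∀ x ∈ P, x < N) →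
    (∀ x ∈ P', x < N') → (∀ x ∈ P, l x ∈ B) → (∀ x ∈ P', l' x ∈ B) →
    EF P l P' l' (cfRank n) ∅ → ev P l N = ev P' l' N' := by
  intro n
  induction n with
  | zero =>
    intro Q _ B hQ _ P P' l l' N N' _ _ _ _ _
    have : IsEmpty Q := by
      rcases Nat.card_eq_zero.1 (Nat.le_zero.1 hQ) with h | h
      exacts [h, absurd h (not_infinite_iff_finite.2 inferInstance)]
    exact Subsingleton.elim _ _
  | succ n ihn =>
    intro Q _ B hQ hB
    -- Inner induction on the number of available transformations, at a cost of `cfRank n + 1`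
    -- rounds for each of them.
    have inner : ∀ (b : ℕ) (B : Set (Q → Q)), B.ncard ≤ b → CounterFree B →
        ∀ {P P' : Set ℕ} {l l' : ℕ → Q → Q} {N N' : ℕ}, (∀ x ∈ P, x < N) →
        (∀ x ∈ P', x < N') → (∀ x ∈ P, l x ∈ B) → (∀ x ∈ P', l' x ∈ B) →
        EF P l P' l' (b * (cfRank n + 1)) ∅ → ev P l N = ev P' l' N' := by
      intro b
      induction b with
      | zero =>
        intro B hb _ P P' l l' N N' _ _ h1 h2 _
        have hB0 : B = ∅ := (Set.ncard_eq_zero (Set.toFinite B)).1 (Nat.le_zero.1 hb)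
        subst hB0
        funext q
        rw [ev_eq_of_forall_notMem (Nat.zero_le N) fun x _ _ h => h1 x h,
          ev_eq_of_forall_notMem (Nat.zero_le N') fun x _ _ h => h2 x h]
        rfl
      | succ b ihb =>
        intro B hb hB P P' l l' N N' hN hN' hl hl' hEF
        -- If all labels are injective they are identities. Otherwise choose a non-injective `c`:
        -- the segments between its occurrences avoid `c` (inner induction), and the blocks act on
        -- the smaller set `Set.range c` (outer induction).
        by_cases hbij : ∀ f ∈ B, Function.Injective f
        · have hid : ∀ {P : Set ℕ} {l : ℕ → Q → Q} (N : ℕ), (∀ x ∈ P, l x ∈ B) →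
              ev P l N = id := by
            intro P l N h
            have : ∀ g, Gen B g → g = id := by
              intro g hg
              induction hg with
              | id => rfl
              | @comp f g hf _ ih =>
                subst ih
                exact funext fun q => hB.eq_of_injective hf (hbij f hf) q
            exact this _ (Gen.ev h N)
          rw [hid N hl, hid N' hl']
        · push Not at hbij
          obtain ⟨c, hcB, hc⟩ := hbij
          set C : Set ℕ := {x ∈ P | l x = c} with hCdef
          set C' : Set ℕ := {x ∈ P' | l' x = c} with hCdef'
          have hcard : Nat.card (Set.range c) ≤ n := by
            have hlt : (Set.range c).ncard < Nat.card Q := by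
              rw [← Set.ncard_univ]
              refine Set.ncard_lt_ncard (Set.ssubset_univ_iff.2 fun h => hc ?_)
              exact Finite.injective_iff_surjective.2 (Set.range_eq_univ.1 h)
            rw [Nat.card_coe_set_eq]; omega
          have hbc : (B \ {c}).ncard ≤ b := by
            have := Set.ncard_sdiff_singleton_lt_of_mem hcB (Set.toFinite B)
            omega
          have hcf : CounterFree (B \ {c}) := fun g hg => hB g (hg.mono Set.sdiff_subset)
          set k₂ := b * (cfRank n + 1) with hk₂
          -- The budget: `cfRank n` rounds for the sequence of blocks, `k₂` for a single segment,
          -- and one round to detect the ends of a segment.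
          rw [show (b + 1) * (cfRank n + 1) = cfRank n + (k₂ + 1) by rw [hk₂]; ring] at hEF
          have hCiff : ∀ {s x y}, PIso l l' s → (x, y) ∈ s → x ∈ P → y ∈ P' →
              (x ∈ C ↔ y ∈ C') := by
            intro s x y hs hxy hx hy
            have := (hs _ hxy).1
            dsimp only at this
            simp [hCdef, hCdef', hx, hy, this]
          -- membership in segments is determined by one round
          have hhead : EF (headSeg P C) l (headSeg P' C') l' k₂ ∅ := by
            refine EF.interp (fun x h => h.1) (fun x h => h.1)
              (hEF.of_le (show k₂ + 1 ≤ _ by omega)) ?_ subset_rfl (by simp)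
            intro s _ hs x hx y hy hxy
            refine ⟨⟨fun h => ⟨hy, fun w' hw' => ?_⟩, fun h => ⟨hx, fun w hw => ?_⟩⟩,
              fun _ _ => (hs.piso _ hxy).1⟩
            · obtain ⟨w, hw, h1⟩ := hs.2.2 w' hw'.1
              have hwC := (hCiff h1.piso (Set.mem_insert _ _) hw hw'.1).2 hw'
              exact (h1.piso.lt_iff (Set.mem_insert_of_mem _ hxy) (Set.mem_insert _ _)).1
                (h.2 w hwC)
            · obtain ⟨w', hw', h1⟩ := hs.2.1 w hw.1
              have hwC := (hCiff h1.piso (Set.mem_insert _ _) hw.1 hw').1 hw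
              exact (h1.piso.lt_iff (Set.mem_insert_of_mem _ hxy) (Set.mem_insert _ _)).2
                (h.2 w' hwC)
          have htail : EF (tailSeg P C) l (tailSeg P' C') l' k₂ ∅ := by
            refine EF.interp (fun x h => h.1) (fun x h => h.1)
              (hEF.of_le (show k₂ + 1 ≤ _ by omega)) ?_ subset_rfl (by simp)
            intro s _ hs x hx y hy hxy
            refine ⟨⟨fun h => ⟨hy, fun w' hw' => ?_⟩, fun h => ⟨hx, fun w hw => ?_⟩⟩,
              fun _ _ => (hs.piso _ hxy).1⟩
            · obtain ⟨w, hw, h1⟩ := hs.2.2 w' hw'.1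
              have hwC := (hCiff h1.piso (Set.mem_insert _ _) hw hw'.1).2 hw'
              exact (h1.piso.lt_iff (Set.mem_insert _ _) (Set.mem_insert_of_mem _ hxy)).1
                (h.2 w hwC)
            · obtain ⟨w', hw', h1⟩ := hs.2.1 w hw.1
              have hwC := (hCiff h1.piso (Set.mem_insert _ _) hw.1 hw').1 hw
              exact (h1.piso.lt_iff (Set.mem_insert _ _) (Set.mem_insert_of_mem _ hxy)).2
                (h.2 w' hwC)
          have hseg : ∀ {s x y}, EF P l P' l' (k₂ + 1) s → (x, y) ∈ s →
              EF (nextSeg P C x) l (nextSeg P' C' y) l' k₂ ∅ := by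
            intro s x y hs hxy
            refine EF.interp (fun x h => h.1) (fun x h => h.1) hs ?_ (Set.empty_subset _)
              (by simp)
            intro s₁ hs₁ hs z hz z' hz' hzz
            have hxy₁ := hs₁ hxy
            have hlt := hs.piso.lt_iff hxy₁ hzz
            dsimp only at hlt
            refine ⟨⟨fun h => ⟨hz', hlt.1 h.2.1, fun w' hw' hxw => ?_⟩,
              fun h => ⟨hz, hlt.2 h.2.1, fun w hw hxw => ?_⟩⟩, fun _ _ => (hs.piso _ hzz).1⟩
            · obtain ⟨w, hw, h1⟩ := hs.2.2 w' hw'.1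
              have hwC := (hCiff h1.piso (Set.mem_insert _ _) hw hw'.1).2 hw'
              exact (h1.piso.lt_iff (Set.mem_insert_of_mem _ hzz) (Set.mem_insert _ _)).1
                (h.2.2 w hwC ((h1.piso.lt_iff (Set.mem_insert_of_mem _ hxy₁)
                  (Set.mem_insert _ _)).2 hxw))
            · obtain ⟨w', hw', h1⟩ := hs.2.1 w hw.1
              have hwC := (hCiff h1.piso (Set.mem_insert _ _) hw.1 hw').1 hw
              exact (h1.piso.lt_iff (Set.mem_insert_of_mem _ hzz) (Set.mem_insert _ _)).2
                (h.2.2 w' hwC ((h1.piso.lt_iff (Set.mem_insert_of_mem _ hxy₁)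
                  (Set.mem_insert _ _)).1 hxw))
          have ehead : ev (headSeg P C) l N = ev (headSeg P' C') l' N' :=
            ihb _ hbc hcf (fun x h => hN x h.1) (fun x h => hN' x h.1)
              (fun x h => ⟨hl x h.1, fun h1 => lt_irrefl x (h.2 x ⟨h.1, h1⟩)⟩)
              (fun x h => ⟨hl' x h.1, fun h1 => lt_irrefl x (h.2 x ⟨h.1, h1⟩)⟩) hhead
          have etail : ev (tailSeg P C) l N = ev (tailSeg P' C') l' N' :=
            ihb _ hbc hcf (fun x h => hN x h.1) (fun x h => hN' x h.1)
              (fun x h => ⟨hl x h.1, fun h1 => lt_irrefl x (h.2 x ⟨h.1, h1⟩)⟩)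
              (fun x h => ⟨hl' x h.1, fun h1 => lt_irrefl x (h.2 x ⟨h.1, h1⟩)⟩) htail
          have eseg : ∀ {s x y}, EF P l P' l' (k₂ + 1) s → (x, y) ∈ s →
              blockMap c P C l N x = blockMap c P' C' l' N' y := by
            intro s x y hs hxy
            have := ihb _ hbc hcf (fun x h => hN x h.1) (fun x h => hN' x h.1)
              (fun z h => ⟨hl z h.1, fun h1 => lt_irrefl z (h.2.2 z ⟨h.1, h1⟩ h.2.1)⟩)
              (fun z h => ⟨hl' z h.1, fun h1 => lt_irrefl z (h.2.2 z ⟨h.1, h1⟩ h.2.1)⟩)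
              (hseg hs hxy)
            funext z
            simp [blockMap, this]
          -- the induced transformations of the range of `c`
          set Bc : Set (Set.range c → Set.range c) :=
            {f | ∃ g, Gen B g ∧ ∀ y, (f y).1 = c (g y.1)} with hBc
          -- Whatever `Bc` generates is the restriction of something generated by `B`, so its
          -- iterates also become stationary.
          have hBcf : CounterFree Bc := by
            intro f hf y
            obtain ⟨g, hg, hfg⟩ : ∃ g, Gen B g ∧ ∀ y, (f y).1 = g y.1 := by
              induction hf with
              | id => exact ⟨id, Gen.id, fun _ => rfl⟩
              | comp h _ ih =>
                obtain ⟨g, hg, h1⟩ := ih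
                obtain ⟨g', hg', h2⟩ := h
                refine ⟨c ∘ (g' ∘ g), Gen.comp hcB (hg'.comp_gen hg), fun y => ?_⟩
                simp [h1, h2]
            have hit : ∀ m, (f^[m] y).1 = g^[m] y.1 := by
              intro m
              induction m with
              | zero => rfl
              | succ m ih => rw [Function.iterate_succ_apply', Function.iterate_succ_apply', hfg, ih]
            obtain ⟨m, hm⟩ := hB g hg y.1
            exact ⟨m, Subtype.ext (by rw [hit, hit, hm])⟩
          -- With `k₂ + 1` rounds left, `eseg` makes the block labels of paired positions equal; by
          -- `EF.interp` the remaining `cfRank n` rounds can be played on the blocks themselves.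
          have hred : EF (notLast C) (blockMap c P C l N) (notLast C') (blockMap c P' C' l' N')
              (cfRank n) ∅ := by
            refine EF.interp (fun x h => h.1.1) (fun x h => h.1.1) hEF ?_ subset_rfl (by simp)
            intro s _ hs x hx y hy hxy
            refine ⟨⟨?_, ?_⟩, fun _ _ => eseg hs hxy⟩
            · rintro ⟨hxC, w, hw, hxw⟩
              obtain ⟨w', hw', h1⟩ := hs.2.1 w hw.1
              refine ⟨(hCiff hs.piso hxy hx hy).1 hxC, w',
                (hCiff h1.piso (Set.mem_insert _ _) hw.1 hw').1 hw, ?_⟩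
              exact (h1.piso.lt_iff (Set.mem_insert_of_mem _ hxy) (Set.mem_insert _ _)).1 hxw
            · rintro ⟨hyC, w', hw', hyw⟩
              obtain ⟨w, hw, h1⟩ := hs.2.2 w' hw'.1
              refine ⟨(hCiff hs.piso hxy hx hy).2 hyC, w,
                (hCiff h1.piso (Set.mem_insert _ _) hw hw'.1).2 hw', ?_⟩
              exact (h1.piso.lt_iff (Set.mem_insert_of_mem _ hxy) (Set.mem_insert _ _)).2 hyw
          have ered : ev (notLast C) (blockMap c P C l N) N =
              ev (notLast C') (blockMap c P' C' l' N') N' :=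
            ihn Bc hcard hBcf (fun x h => hN x h.1.1) (fun x h => hN' x h.1.1)
              (fun x h => ⟨_, Gen.ev (fun z hz => hl z hz.1) N, fun y => rfl⟩)
              (fun x h => ⟨_, Gen.ev (fun z hz => hl' z hz.1) N', fun y => rfl⟩) hred
          have hEF1 : EF P l P' l' 1 ∅ := hEF.of_le (by omega)
          rcases C.eq_empty_or_nonempty with hCe | hCne
          · have hCe' : C' = ∅ := by
              rw [Set.eq_empty_iff_forall_notMem] at hCe ⊢
              intro y hy
              obtain ⟨x, hx, h1⟩ := hEF1.2.2 y hy.1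
              exact hCe x ((hCiff h1.piso (Set.mem_insert _ _) hx hy.1).2 hy)
            simpa [headSeg, hCe, hCe'] using ehead
          · have hCne' : C'.Nonempty := by
              obtain ⟨x, hx⟩ := hCne
              obtain ⟨y, hy, h1⟩ := hEF1.2.1 x hx.1
              exact ⟨y, (hCiff h1.piso (Set.mem_insert _ _) hx.1 hy).1 hx⟩
            funext q
            rw [ev_blocks c (fun x h => h.1) (fun x h => h.2) hN hCne,
              ev_blocks c (fun x h => h.1) (fun x h => h.2) hN' hCne', ehead, etail, ered]
    intro P P' l l' N N' hN hN' hl hl' hEF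
    refine inner ((n + 1) ^ (n + 1)) B ?_ hB hN hN' hl hl' hEF
    calc B.ncard ≤ Nat.card (Q → Q) := by
          rw [← Set.ncard_univ]; exact Set.ncard_le_ncard (Set.subset_univ _)
      _ = Nat.card Q ^ Nat.card Q := by
          cases nonempty_fintype Q
          classical
          rw [Nat.card_eq_fintype_card, Nat.card_eq_fintype_card, Fintype.card_fun]
      _ ≤ _ := pow_self_le hQ

end Eval

/-! ### Equivalence of words -/

section Words

variable {α : Type*}

/-- The positions of a word. -/
def wpos (u : List α) : Set ℕ := {i | i < u.length}

/-- The label of a position of a word. -/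
def wlab (u : List α) (i : ℕ) : Option α := u[i]?

/-- Equivalence of rank `k` of two words with distinguished positions. -/
abbrev WEF (k : ℕ) (u v : List α) (s : Set (ℕ × ℕ)) : Prop := EF (wpos u) (wlab u) (wpos v) (wlab v) k s

/-- The pairs of corresponding entries. -/
def zipSet (t t' : List ℕ) : Set (ℕ × ℕ) := {p | p ∈ t.zip t'}

@[simp] theorem zipSet_nil : zipSet [] [] = ∅ := by simp [zipSet]

theorem zipSet_concat {t t' : List ℕ} (h : t.length = t'.length) (x y : ℕ) :
    zipSet (t ++ [x]) (t' ++ [y]) = insert (x, y) (zipSet t t') := by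
  ext p
  simp [zipSet, List.zip_append h, or_comm]

theorem zipSet_cons (t t' : List ℕ) (x y : ℕ) :
    zipSet (x :: t) (y :: t') = insert (x, y) (zipSet t t') := by
  ext p
  simp [zipSet]

theorem swap_preimage_zipSet (t t' : List ℕ) : Prod.swap ⁻¹' zipSet t t' = zipSet t' t := by
  induction t generalizing t' with
  | nil => ext; simp [zipSet]
  | cons x t ih =>
    cases t' with
    | nil => ext; simp [zipSet]
    | cons y t' =>
      rw [zipSet_cons, zipSet_cons, ← ih]
      ext ⟨a, b⟩
      simp [and_comm]

theorem mem_zipSet_iff {t t' : List ℕ} (h : t.length = t'.length) {p : ℕ × ℕ} :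
    p ∈ zipSet t t' ↔ ∃ i < t.length, p = (t.getD i 0, t'.getD i 0) := by
  change p ∈ t.zip t' ↔ _
  simp only [List.mem_iff_getElem, List.length_zip, List.getElem_zip]
  constructor
  · rintro ⟨i, hi, rfl⟩
    refine ⟨i, by omega, ?_⟩
    rw [List.getD_eq_getElem _ _ (show i < t.length by omega),
      List.getD_eq_getElem _ _ (show i < t'.length by omega)]
  · rintro ⟨i, hi, rfl⟩
    refine ⟨i, by omega, ?_⟩
    rw [List.getD_eq_getElem _ _ hi, List.getD_eq_getElem _ _ (show i < t'.length by omega)]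

/-- A move in the common suffix `w` is answered by the corresponding position of `w`, any other move
by the given strategy. The diagonal pairs of `w` are in the relation from the start, so a move there
adds nothing and only uses up a round. -/
theorem WEF.append {k : ℕ} {u v : List α} {s : Set (ℕ × ℕ)} (h : WEF k u v s)
    (hs : ∀ p ∈ s, p.1 < u.length ∧ p.2 < v.length) (w : List α) :
    WEF k (u ++ w) (v ++ w) (s ∪ {p | ∃ j < w.length, p = (u.length + j, v.length + j)}) := by
  have base : ∀ {s : Set (ℕ × ℕ)}, PIso (wlab u) (wlab v) s →
      (∀ p ∈ s, p.1 < u.length ∧ p.2 < v.length) →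
      PIso (wlab (u ++ w)) (wlab (v ++ w))
        (s ∪ {p | ∃ j < w.length, p = (u.length + j, v.length + j)}) := by
    intro s h hs p hp
    refine ⟨?_, fun q hq => ?_⟩
    · rcases hp with hp | ⟨j, hj, rfl⟩
      · have := (h p hp).1
        simpa [wlab, List.getElem?_append, hs p hp] using this
      · simp [wlab, List.getElem?_append]
    · rcases hp with hp | ⟨j, hj, rfl⟩ <;> rcases hq with hq | ⟨j', hj', rfl⟩
      · exact (h p hp).2 q hq
      · have := hs p hp
        constructor <;> intro <;> dsimp only <;> omega
      · have := hs q hq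
        constructor <;> dsimp only <;> intro <;> omega
      · simp
  induction k generalizing s with
  | zero => exact base h hs
  | succ k ih =>
    have hdiag : ∀ j < w.length,
        WEF k (u ++ w) (v ++ w) (insert (u.length + j, v.length + j)
          (s ∪ {p | ∃ j < w.length, p = (u.length + j, v.length + j)})) := by
      intro j hj
      have hm : (u.length + j, v.length + j) ∈
          s ∪ {p | ∃ j < w.length, p = (u.length + j, v.length + j)} := Or.inr ⟨j, hj, rfl⟩
      rw [Set.insert_eq_of_mem hm]
      exact ih h.of_succ hs
    have hins : ∀ x < u.length, ∀ y < v.length, WEF k u v (insert (x, y) s) →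
        WEF k (u ++ w) (v ++ w) (insert (x, y)
          (s ∪ {p | ∃ j < w.length, p = (u.length + j, v.length + j)})) := by
      intro x hx y hy h'
      rw [← Set.insert_union]
      refine ih h' ?_
      rintro p (rfl | hp)
      exacts [⟨hx, hy⟩, hs p hp]
    refine ⟨base h.1 hs, fun x hx => ?_, fun y hy => ?_⟩
    · have hx : x < (u ++ w).length := hx
      rw [List.length_append] at hx
      by_cases hxu : x < u.length
      · obtain ⟨y, hy, h'⟩ := h.2.1 x hxu
        have hy : y < v.length := hy
        exact ⟨y, show y < (v ++ w).length by rw [List.length_append]; omega, hins x hxu y hy h'⟩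
      · obtain ⟨j, rfl⟩ := Nat.exists_eq_add_of_le (not_lt.1 hxu)
        exact ⟨v.length + j, show v.length + j < (v ++ w).length by
          rw [List.length_append]; omega, hdiag j (by omega)⟩
    · have hy : y < (v ++ w).length := hy
      rw [List.length_append] at hy
      by_cases hyv : y < v.length
      · obtain ⟨x, hx, h'⟩ := h.2.2 y hyv
        have hx : x < u.length := hx
        exact ⟨x, show x < (u ++ w).length by rw [List.length_append]; omega, hins x hx y hyv h'⟩
      · obtain ⟨j, rfl⟩ := Nat.exists_eq_add_of_le (not_lt.1 hyv)
        exact ⟨u.length + j, show u.length + j < (u ++ w).length by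
          rw [List.length_append]; omega, hdiag j (by omega)⟩

theorem EF.play {A : Type*} {P P' : Set ℕ} {l l' : ℕ → A} {k : ℕ} (t : List ℕ) {s : Set (ℕ × ℕ)}
    (h : EF P l P' l' (k + t.length) s) (ht : ∀ x ∈ t, x ∈ P) :
    ∃ t' : List ℕ, t'.length = t.length ∧ (∀ y ∈ t', y ∈ P') ∧ EF P l P' l' k (s ∪ zipSet t t') := by
  induction t generalizing s with
  | nil => exact ⟨[], rfl, by simp, by simpa using h⟩
  | cons x t ih =>
    obtain ⟨y, hy, h'⟩ := EF.of_le (k := k + t.length + 1) h (by simp) |>.2.1 x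
      (ht x (by simp))
    obtain ⟨t', h1, h2, h3⟩ := ih h' fun z hz => ht z (by simp [hz])
    refine ⟨y :: t', by simp [h1], by simpa using ⟨hy, h2⟩, ?_⟩
    rw [zipSet_cons, Set.union_insert, ← Set.insert_union]
    exact h3

/-! ### Counting types, and short representatives of words -/

/-- The atomic type of at most `D` distinguished positions. -/
abbrev AtomTy (α : Type*) (D : ℕ) : Type _ := (Fin D → Fin D → Prop) × (Fin D → Option α)

/-- Types of rank `k` of words with distinguished positions. -/
def Ty (α : Type*) (D : ℕ) : ℕ → Type _
  | 0 => AtomTy α D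
  | k + 1 => AtomTy α D × Set (Ty α D k)

/-- The atomic type of a word with distinguished positions. -/
def atomTy (D : ℕ) (u : List α) (t : List ℕ) : AtomTy α D :=
  (fun i j => t.getD i 0 ≤ t.getD j 0, fun i => wlab u (t.getD i 0))

/-- The type of a word with distinguished positions. -/
def wordTy (D : ℕ) (u : List α) : (k : ℕ) → List ℕ → Ty α D k
  | 0, t => atomTy D u t
  | k + 1, t => (atomTy D u t, {τ | ∃ x ∈ wpos u, wordTy D u k (t ++ [x]) = τ})

theorem piso_of_atomTy_eq {D : ℕ} {u v : List α} {t t' : List ℕ} (h : atomTy D u t = atomTy D v t')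
    (ht : t.length = t'.length) (hD : t.length ≤ D) : PIso (wlab u) (wlab v) (zipSet t t') := by
  intro p hp
  obtain ⟨i, hi, rfl⟩ := (mem_zipSet_iff ht).1 hp
  refine ⟨congrFun (congrArg Prod.snd h) ⟨i, by omega⟩, fun q hq => ?_⟩
  obtain ⟨j, hj, rfl⟩ := (mem_zipSet_iff ht).1 hq
  exact iff_of_eq (congrFun (congrFun (congrArg Prod.fst h) ⟨i, by omega⟩) ⟨j, by omega⟩)

/-- Equal types contain the duplicator's answers. The bound `D` stays fixed through all ranks;
indices beyond the length of `t` read the default position `0`, which is harmless as only the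
indices below `t.length ≤ D` are compared. -/
theorem WEF.of_wordTy_eq {D k : ℕ} {u v : List α} {t t' : List ℕ}
    (h : wordTy D u k t = wordTy D v k t') (ht : t.length = t'.length) (hD : t.length + k ≤ D) :
    WEF k u v (zipSet t t') := by
  induction k generalizing t t' with
  | zero => exact piso_of_atomTy_eq h ht hD
  | succ k ih =>
    have h2 := congrArg Prod.snd h
    refine ⟨piso_of_atomTy_eq (congrArg Prod.fst h) ht (by omega), fun x hx => ?_, fun y hy => ?_⟩
    · obtain ⟨y, hy, h'⟩ : wordTy D u k (t ++ [x]) ∈ (wordTy D v (k + 1) t').2 :=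
        h2 ▸ ⟨x, hx, rfl⟩
      exact ⟨y, hy, zipSet_concat ht x y ▸ ih h'.symm (by simp [ht]) (by simp; omega)⟩
    · obtain ⟨x, hx, h'⟩ : wordTy D v k (t' ++ [y]) ∈ (wordTy D u (k + 1) t).2 :=
        h2 ▸ ⟨y, hy, rfl⟩
      exact ⟨x, hx, zipSet_concat ht x y ▸ ih h' (by simp [ht]) (by simp; omega)⟩

/-- The number of types over an alphabet with `b` letters. -/
def tyBound (b D : ℕ) : ℕ → ℕ
  | 0 => (2 ^ D) ^ D * (b + 1) ^ D
  | k + 1 => (2 ^ D) ^ D * (b + 1) ^ D * 2 ^ tyBound b D k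

/-- The number itself is needed, and not only finiteness, because the bound on short words has to be
computed. -/
theorem finite_card_Ty (α : Type*) [Fintype α] (D k : ℕ) :
    Finite (Ty α D k) ∧ Nat.card (Ty α D k) = tyBound (Fintype.card α) D k := by
  classical
  have h0 : Nat.card (AtomTy α D) = (2 ^ D) ^ D * (Fintype.card α + 1) ^ D := by
    rw [Nat.card_eq_fintype_card]
    simp [AtomTy]
  induction k with
  | zero => exact ⟨inferInstanceAs (Finite (AtomTy α D)), h0⟩
  | succ k ih =>
    obtain ⟨ih1, ih2⟩ := ih
    refine ⟨inferInstanceAs (Finite (AtomTy α D × Set (Ty α D k))), ?_⟩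
    change Nat.card (AtomTy α D × Set (Ty α D k)) = _
    have := Fintype.ofFinite (Ty α D k)
    rw [Nat.card_prod, h0, tyBound, ← ih2, Nat.card_eq_fintype_card, Fintype.card_set,
      Nat.card_eq_fintype_card]

/-- Every word is equivalent to a short one. -/
theorem exists_short_WEF [Fintype α] (k : ℕ) (u : List α) :
    ∃ v : List α, v.length < tyBound (Fintype.card α) k k ∧ WEF k u v ∅ := by
  induction hn : u.length using Nat.strong_induction_on generalizing u with
  | _ n ih =>
    subst hn
    obtain ⟨hfin, hcard⟩ := finite_card_Ty α k k
    by_cases hu : u.length < tyBound (Fintype.card α) k k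
    · exact ⟨u, hu, by simpa using WEF.of_wordTy_eq (D := k) (t := []) (t' := []) rfl rfl (by simp)⟩
    -- There are more prefixes than types, so two prefixes of different lengths are equivalent.
    -- Deleting the factor between them preserves equivalence by `WEF.append`.
    · obtain ⟨i, j, hij, hty⟩ : ∃ i j : Fin (u.length + 1), i ≠ j ∧
          wordTy k (u.take i) k [] = wordTy k (u.take j) k [] := by
        have := Fintype.ofFinite (Ty α k k)
        refine Fintype.exists_ne_map_eq_of_card_lt
          (fun i : Fin (u.length + 1) => wordTy k (u.take i) k []) ?_
        rw [Fintype.card_fin, ← Nat.card_eq_fintype_card, hcard]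
        omega
      wlog hlt : i < j generalizing i j
      · exact this j i hij.symm hty.symm (lt_of_le_of_ne (not_lt.1 hlt) hij.symm)
      have h1 : WEF k (u.take j) (u.take i) ∅ := by
        simpa using WEF.of_wordTy_eq (D := k) hty.symm rfl (by simp)
      have h2 := (WEF.append h1 (by simp) (u.drop j)).anti (Set.empty_subset _)
      rw [List.take_append_drop] at h2
      have hi := i.2
      have hj := j.2
      have hlt' : i.1 < j.1 := hlt
      obtain ⟨v, hv, h3⟩ := ih _ (by simp; omega) (u.take i ++ u.drop j) rfl
      exact ⟨v, hv, (h2.trans h3).anti (Set.empty_subset _)⟩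

end Words

/-! ### Hintikka formulas -/

namespace FO

variable {α : Type*}

/-- Conjunction of a list of formulas. -/
def conj : List (FO α) → FO α
  | [] => top
  | φ :: L => and φ (conj L)

/-- Disjunction of a list of formulas. -/
def disj (L : List (FO α)) : FO α := neg (conj (L.map neg))

/-- Existential quantification. -/
def ex (x : ℕ) (φ : FO α) : FO α := neg (all x (neg φ))

variable {u : List α} {σ : ℕ → Fin u.length}

@[simp] theorem sat_conj {L : List (FO α)} : Sat u σ (conj L) ↔ ∀ φ ∈ L, Sat u σ φ := by
  induction L with
  | nil => simp [conj, Sat]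
  | cons φ L ih => simp [conj, Sat, ih]

@[simp] theorem sat_disj {L : List (FO α)} : Sat u σ (disj L) ↔ ∃ φ ∈ L, Sat u σ φ := by
  simp [disj, Sat]

@[simp] theorem sat_ex {x : ℕ} {φ : FO α} :
    Sat u σ (ex x φ) ↔ ∃ i, Sat u (Function.update σ x i) φ := by
  simp [ex, Sat]

theorem fv_conj_subset {L : List (FO α)} {V : Set ℕ} (h : ∀ φ ∈ L, φ.fv ⊆ V) :
    (conj L).fv ⊆ V := by
  induction L with
  | nil => simp [conj, fv]
  | cons φ L ih =>
    simp only [conj, fv, Set.union_subset_iff]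
    exact ⟨h φ (by simp), ih fun ψ hψ => h ψ (by simp [hψ])⟩

theorem fv_disj_subset {L : List (FO α)} {V : Set ℕ} (h : ∀ φ ∈ L, φ.fv ⊆ V) :
    (disj L).fv ⊆ V :=
  fv_conj_subset fun φ hφ => by
    obtain ⟨ψ, hψ, rfl⟩ := List.mem_map.1 hφ
    exact h ψ hψ

/-- The label of the position `x`, as a formula on the variable `i`. -/
def labelAt (w : List α) (x i : ℕ) : FO α := (w[x]?).elim top fun a => letter a i

/-- The order of the positions `x` and `y`, as a formula on the variables `i` and `j`. -/
def orderAt (x y i j : ℕ) : FO α := if x ≤ y then le i j else neg (le i j)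

/-- The atomic diagram of the word `w` with positions `t` for the first variables. -/
def diagram (w : List α) (t : List ℕ) : FO α :=
  and (conj ((List.range t.length).map fun i => labelAt w (t.getD i 0) i))
    (conj ((List.range t.length).map fun i =>
      conj ((List.range t.length).map fun j => orderAt (t.getD i 0) (t.getD j 0) i j)))

/-- The Hintikka formula of rank `k` of the word `w` with positions `t` for the first variables. -/
def hintikka (w : List α) : ℕ → List ℕ → FO α
  | 0, t => diagram w t
  | k + 1, t => and (diagram w t)
      (and (conj (((List.range w.length).map fun x => hintikka w k (t ++ [x])).map (ex t.length)))
        (all t.length (disj ((List.range w.length).map fun x => hintikka w k (t ++ [x])))))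

theorem fv_diagram_subset (w : List α) (t : List ℕ) : (diagram w t).fv ⊆ {i | i < t.length} := by
  simp only [diagram, fv, Set.union_subset_iff]
  constructor
  · refine fv_conj_subset fun φ hφ => ?_
    obtain ⟨i, hi, rfl⟩ := List.mem_map.1 hφ
    rw [List.mem_range] at hi
    unfold labelAt
    cases w[t.getD i 0]? <;> simp [fv, hi]
  · refine fv_conj_subset fun φ hφ => ?_
    obtain ⟨i, hi, rfl⟩ := List.mem_map.1 hφ
    refine fv_conj_subset fun φ hφ => ?_
    obtain ⟨j, hj, rfl⟩ := List.mem_map.1 hφ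
    rw [List.mem_range] at hi hj
    unfold orderAt
    split_ifs <;> simp [fv, Set.insert_subset_iff, hi, hj]

theorem fv_hintikka_subset (w : List α) (k : ℕ) (t : List ℕ) :
    (hintikka w k t).fv ⊆ {i | i < t.length} := by
  induction k generalizing t with
  | zero => exact fv_diagram_subset w t
  | succ k ih =>
    have key : ∀ x, (hintikka w k (t ++ [x])).fv \ {t.length} ⊆ {i | i < t.length} := by
      rintro x i ⟨h1, h2⟩
      have := ih _ h1
      simp only [List.length_append, List.length_singleton, Set.mem_ofPred_eq,
        Set.mem_singleton_iff] at this h2 ⊢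
      omega
    simp only [hintikka, fv, Set.union_subset_iff]
    refine ⟨fv_diagram_subset w t, fv_conj_subset fun φ hφ => ?_, ?_⟩
    · simp only [List.map_map, List.mem_map, Function.comp_apply] at hφ
      obtain ⟨x, _, rfl⟩ := hφ
      exact key x
    · rw [Set.sdiff_subset_iff]
      refine fv_disj_subset fun φ hφ => ?_
      obtain ⟨x, _, rfl⟩ := List.mem_map.1 hφ
      rw [← Set.sdiff_subset_iff]
      exact key x

/-- The positions of the first `d` variables. -/
def vals (σ : ℕ → Fin u.length) (d : ℕ) : List ℕ := (List.range d).map fun i => (σ i).1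

@[simp] theorem length_vals (d : ℕ) : (vals σ d).length = d := by simp [vals]

theorem getD_vals {d i : ℕ} (h : i < d) : (vals σ d).getD i 0 = (σ i).1 := by
  simp [vals, h]

theorem vals_update (d : ℕ) (i : Fin u.length) :
    vals (Function.update σ d i) (d + 1) = vals σ d ++ [i.1] := by
  simp only [vals, List.range_succ, List.map_append, List.map_cons, List.map_nil,
    Function.update_self, List.append_cancel_right_eq]
  refine List.map_congr_left fun j hj => ?_
  rw [Function.update_of_ne (List.mem_range.1 hj).ne]

theorem sat_diagram {w : List α} {t : List ℕ} (ht : ∀ x ∈ t, x < w.length) :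
    Sat u σ (diagram w t) ↔ PIso (wlab w) (wlab u) (zipSet t (vals σ t.length)) := by
  have hlen : t.length = (vals σ t.length).length := by simp
  have hlab : ∀ i < t.length, Sat u σ (labelAt w (t.getD i 0) i) ↔
      wlab w (t.getD i 0) = wlab u (σ i).1 := by
    intro i hi
    have : t.getD i 0 < w.length := ht _ (by rw [List.getD_eq_getElem _ _ hi]; simp)
    rw [labelAt, wlab, wlab, List.getElem?_eq_getElem this, List.getElem?_eq_getElem (σ i).2]
    simp [Sat, eq_comm]
  have hord : ∀ i j, Sat u σ (orderAt (t.getD i 0) (t.getD j 0) i j) ↔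
      (t.getD i 0 ≤ t.getD j 0 ↔ (σ i).1 ≤ (σ j).1) := by
    intro i j
    unfold orderAt
    split_ifs with h
    · simp only [Sat, h, true_iff]; rfl
    · simp only [Sat, h, false_iff]; rfl
  simp only [diagram, Sat, sat_conj, List.forall_mem_map, List.mem_range, hord]
  constructor
  · rintro ⟨h1, h2⟩ p hp
    obtain ⟨i, hi, rfl⟩ := (mem_zipSet_iff hlen).1 hp
    refine ⟨?_, fun q hq => ?_⟩
    · rw [getD_vals hi]
      exact (hlab i hi).1 (h1 i hi)
    · obtain ⟨j, hj, rfl⟩ := (mem_zipSet_iff hlen).1 hq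
      rw [getD_vals hi, getD_vals hj]
      exact h2 i hi j hj
  · intro h
    have hmem : ∀ i < t.length, (t.getD i 0, (σ i).1) ∈ zipSet t (vals σ t.length) :=
      fun i hi => (mem_zipSet_iff hlen).2 ⟨i, hi, by rw [getD_vals hi]⟩
    exact ⟨fun i hi => (hlab i hi).2 (h _ (hmem i hi)).1,
      fun i hi j hj => (h _ (hmem i hi)).2 _ (hmem j hj)⟩

/-- The last two conjuncts of a Hintikka formula spell out the spoiler's moves in `w` and in `u`.
Positions of `w` are enumerated in the formula, while those of `u` are quantified by the variable
`t.length`, the first one that does not name a position yet. -/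
theorem sat_hintikka {w : List α} {k : ℕ} {t : List ℕ} (ht : ∀ x ∈ t, x < w.length) :
    Sat u σ (hintikka w k t) ↔ WEF k w u (zipSet t (vals σ t.length)) := by
  induction k generalizing t σ with
  | zero => exact sat_diagram ht
  | succ k ih =>
    have key : ∀ x < w.length, ∀ i : Fin u.length,
        Sat u (Function.update σ t.length i) (hintikka w k (t ++ [x])) ↔
          WEF k w u (insert (x, i.1) (zipSet t (vals σ t.length))) := by
      intro x hx i
      rw [ih (by simpa [or_imp, forall_and] using ⟨ht, hx⟩), List.length_append,
        List.length_singleton, vals_update, zipSet_concat (by simp)]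
    simp only [hintikka, Sat, sat_diagram ht, sat_conj, sat_disj, List.forall_mem_map,
      List.mem_range, sat_ex, EF]
    refine and_congr Iff.rfl (and_congr ?_ ?_)
    · refine forall₂_congr fun x hx => ?_
      simp only [key x hx]
      exact ⟨fun ⟨i, h⟩ => ⟨i.1, i.2, h⟩, fun ⟨y, hy, h⟩ => ⟨⟨y, hy⟩, h⟩⟩
    · constructor
      · intro h y hy
        obtain ⟨φ, hφ, h'⟩ := h ⟨y, hy⟩
        obtain ⟨x, hx, rfl⟩ := List.mem_map.1 hφ
        rw [List.mem_range] at hx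
        exact ⟨x, hx, (key x hx _).1 h'⟩
      · intro h i
        obtain ⟨x, hx, h'⟩ := h i.1 i.2
        exact ⟨_, List.mem_map.2 ⟨x, List.mem_range.2 hx, rfl⟩, (key x hx _).2 h'⟩

end FO

/-! ### Lists of weighted transitions -/

/-- A weighted transition: source, letter, target, weight. -/
abbrev Edge (α R : Type*) := ℕ × α × ℕ × R

section Edges

variable {α R : Type*}

/-- `ρ` is a sequence of consecutive transitions from `p` to `q`. -/
def Path : ℕ → ℕ → List (Edge α R) → Prop
  | p, q, [] => p = q
  | p, q, δ :: ρ => δ.1 = p ∧ Path δ.2.2.1 q ρ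

theorem path_append {p q : ℕ} {ρ ρ' : List (Edge α R)} :
    Path p q (ρ ++ ρ') ↔ ∃ s, Path p s ρ ∧ Path s q ρ' := by
  induction ρ generalizing p with
  | nil => simp [Path]
  | cons δ ρ ih => simp [Path, ih, and_assoc]

theorem path_concat {p q : ℕ} {ρ : List (Edge α R)} {δ : Edge α R} :
    Path p q (ρ ++ [δ]) ↔ Path p δ.1 ρ ∧ δ.2.2.1 = q := by
  rw [path_append]
  simp only [Path]
  exact ⟨fun ⟨s, h1, h2, h3⟩ => ⟨h2 ▸ h1, h3⟩, fun ⟨h1, h2⟩ => ⟨_, h1, rfl, h2⟩⟩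

/-- `ρ` is a run from `p` to `q` with label `u`, with transitions from `l`. -/
def Run (l : List (Edge α R)) (p q : ℕ) (u : List α) (ρ : List (Edge α R)) : Prop :=
  (∀ δ ∈ ρ, δ ∈ l) ∧ Path p q ρ ∧ ρ.map (fun δ => δ.2.1) = u

theorem Run.length_eq {l : List (Edge α R)} {p q : ℕ} {u : List α} {ρ : List (Edge α R)}
    (h : Run l p q u ρ) : ρ.length = u.length := by
  rw [← h.2.2, List.length_map]

theorem exists_run_append {l : List (Edge α R)} {p q : ℕ} {u v : List α} :
    (∃ ρ, Run l p q (u ++ v) ρ) ↔ ∃ s, (∃ ρ, Run l p s u ρ) ∧ ∃ ρ, Run l s q v ρ := by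
  constructor
  · rintro ⟨ρ, h1, h2, h3⟩
    obtain ⟨ρ₁, ρ₂, rfl, h4, h5⟩ := List.map_eq_append_iff.1 h3
    obtain ⟨s, h6, h7⟩ := path_append.1 h2
    exact ⟨s, ⟨ρ₁, fun δ hδ => h1 δ (by simp [hδ]), h6, h4⟩,
      ρ₂, fun δ hδ => h1 δ (by simp [hδ]), h7, h5⟩
  · rintro ⟨s, ⟨ρ₁, h1, h2, h3⟩, ρ₂, h4, h5, h6⟩
    refine ⟨ρ₁ ++ ρ₂, fun δ hδ => ?_, path_append.2 ⟨s, h2, h5⟩, by simp [h3, h6]⟩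
    exact (List.mem_append.1 hδ).elim (h1 δ) (h4 δ)

theorem exists_run_nil {l : List (Edge α R)} {p q : ℕ} : (∃ ρ, Run l p q [] ρ) ↔ p = q := by
  constructor
  · rintro ⟨ρ, h1, h2, h3⟩
    rw [List.map_eq_nil_iff] at h3
    subst h3
    exact h2
  · rintro rfl
    exact ⟨[], by simp, rfl, rfl⟩

/-- Aperiodicity of a list of transitions. -/
def EdgesAperiodic (l : List (Edge α R)) : Prop :=
  ∃ m : ℕ, ∀ (p q : ℕ) (u : List α), u ≠ [] →
    ((∃ ρ, Run l p q (List.replicate m u).flatten ρ) ↔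
      ∃ ρ, Run l p q (List.replicate (m + 1) u).flatten ρ)

/-- Unambiguity of a list of transitions within strongly connected components. -/
def EdgesUnambiguous (l : List (Edge α R)) : Prop :=
  ∀ p q : ℕ, (∃ u ρ, Run l p q u ρ) → (∃ u ρ, Run l q p u ρ) →
    ∀ u ρ ρ', Run l p q u ρ → Run l p q u ρ' → ρ = ρ'

/-- The states that occur in a list of transitions. -/
def states (l : List (Edge α R)) : List ℕ := l.map (fun δ => δ.1) ++ l.map (fun δ => δ.2.2.1)

/-- The type of states that occur in a list of transitions. -/
abbrev State (l : List (Edge α R)) := {x : ℕ // x ∈ states l}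

instance (l : List (Edge α R)) : Finite (State l) := (List.finite_toSet (states l)).to_subtype

theorem card_state_le (l : List (Edge α R)) : Nat.card (State l) ≤ 2 * l.length := by
  have hlen : (states l).length = 2 * l.length := by simp [states]; omega
  let f : Fin (states l).length → State l := fun i => ⟨(states l)[i], List.getElem_mem _⟩
  have hf : Function.Surjective f := by
    rintro ⟨x, hx⟩
    obtain ⟨i, hi, rfl⟩ := List.mem_iff_getElem.1 hx
    exact ⟨⟨i, hi⟩, rfl⟩
  simpa [hlen] using Nat.card_le_card_of_surjective f hf

theorem src_mem_states {l : List (Edge α R)} {δ : Edge α R} (h : δ ∈ l) : δ.1 ∈ states l :=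
  List.mem_append_left _ (List.mem_map_of_mem h)

theorem tgt_mem_states {l : List (Edge α R)} {δ : Edge α R} (h : δ ∈ l) : δ.2.2.1 ∈ states l :=
  List.mem_append_right _ (List.mem_map_of_mem h)

theorem Run.source_mem {l : List (Edge α R)} {p q : ℕ} {u : List α} {ρ : List (Edge α R)}
    (h : Run l p q u ρ) (hu : u ≠ []) : p ∈ states l := by
  obtain ⟨h1, h2, h3⟩ := h
  cases ρ with
  | nil => exact absurd h3.symm hu
  | cons δ ρ => exact h2.1 ▸ src_mem_states (h1 δ (by simp))

theorem Run.target_mem {l : List (Edge α R)} {p q : ℕ} {u : List α} {ρ : List (Edge α R)}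
    (h : Run l p q u ρ) (hu : u ≠ []) : q ∈ states l := by
  obtain ⟨h1, h2, h3⟩ := h
  rcases List.eq_nil_or_concat ρ with rfl | ⟨ρ, δ, rfl⟩
  · exact absurd h3.symm hu
  · rw [List.concat_eq_append] at *
    exact (path_concat.1 h2).2 ▸ tgt_mem_states (h1 δ (by simp))

/-! ### The subset construction and its counter-free actions -/

/-- The action of a set of transitions on sets of states. -/
def act (l : List (Edge α R)) (T : Set (Edge α R)) (X : Set (State l)) : Set (State l) :=
  {y | ∃ δ ∈ T, δ ∈ l ∧ (∃ x ∈ X, x.1 = δ.1) ∧ y.1 = δ.2.2.1}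

theorem act_empty (l : List (Edge α R)) (T : Set (Edge α R)) : act l T ∅ = ∅ := by
  ext y; simp [act]

/-- The actions of letters and of at most one transition. -/
def actions (l : List (Edge α R)) : Set (Set (State l) → Set (State l)) :=
  {f | (∃ a, f = act l {δ | δ.2.1 = a}) ∨ ∃ T : Set (Edge α R), T.Subsingleton ∧ f = act l T}

/-- This is the subset construction with a separate set of allowed transitions at each position, so
that letters and prescribed transitions are treated alike. -/
theorem mem_ev_act {l : List (Edge α R)} {T : ℕ → Set (Edge α R)} {P : Set ℕ} {n : ℕ}
    (hP : ∀ i < n, i ∈ P) (X : Set (State l)) (y : State l) :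
    y ∈ ev P (fun i => act l (T i)) n X ↔ ∃ ρ : List (Edge α R), ρ.length = n ∧ (∀ δ ∈ ρ, δ ∈ l) ∧
      (∃ x ∈ X, Path x.1 y.1 ρ) ∧ ∀ i δ, ρ[i]? = some δ → δ ∈ T i := by
  induction n generalizing y with
  | zero =>
    constructor
    · intro h
      exact ⟨[], rfl, by simp, ⟨y, h, rfl⟩, by simp⟩
    · rintro ⟨ρ, h1, -, ⟨x, hx, h2⟩, -⟩
      rw [List.length_eq_zero_iff] at h1
      subst h1
      obtain rfl : x = y := Subtype.ext h2
      exact hx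
  | succ n ih =>
    rw [ev_succ_of_mem (hP n (by omega))]
    specialize ih fun i hi => hP i (by omega)
    constructor
    · rintro ⟨δ, hδT, hδl, ⟨z, hz, hzδ⟩, hy⟩
      obtain ⟨ρ, h1, h2, ⟨x, hx, h3⟩, h4⟩ := (ih z).1 hz
      refine ⟨ρ ++ [δ], by simp [h1], ?_, ⟨x, hx, path_concat.2 ⟨hzδ ▸ h3, hy.symm⟩⟩, ?_⟩
      · intro δ' h
        rcases List.mem_append.1 h with h | h
        exacts [h2 δ' h, List.mem_singleton.1 h ▸ hδl]
      · intro i δ' hi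
        rcases lt_trichotomy i ρ.length with h | h | h
        · rw [List.getElem?_append_left h] at hi
          exact h4 i δ' hi
        · subst h
          simp at hi
          subst hi
          exact h1 ▸ hδT
        · rw [List.getElem?_eq_none (by simp; omega)] at hi
          cases hi
    · rintro ⟨ρ, h1, h2, ⟨x, hx, h3⟩, h4⟩
      rcases List.eq_nil_or_concat ρ with rfl | ⟨ρ, δ, rfl⟩
      · simp at h1
      · rw [List.concat_eq_append] at *
        obtain ⟨h5, h6⟩ := path_concat.1 h3
        have hn : ρ.length = n := by simpa using h1
        have hδl : δ ∈ l := h2 δ (by simp)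
        refine ⟨δ, h4 n δ (by simp [← hn]), hδl, ⟨⟨δ.1, src_mem_states hδl⟩, ?_, rfl⟩, h6.symm⟩
        refine (ih _).2 ⟨ρ, hn, fun δ' h => h2 δ' (by simp [h]), ⟨x, hx, h5⟩, fun i δ' hi => ?_⟩
        refine h4 i δ' ?_
        rw [List.getElem?_append_left]
        · exact hi
        · by_contra hcon
          rw [List.getElem?_eq_none (by omega)] at hi
          cases hi

/-- A product of letter actions is the action of a word `u`, and aperiodicity compares its powers.
If some factor uses at most one transition, the set reached right after it is empty or always the
same, so the product has at most one nonempty value. -/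
theorem counterFree_actions {l : List (Edge α R)} (hl : EdgesAperiodic l) :
    CounterFree (actions l) := by
  intro g hg
  have hg0 : g ∅ = ∅ := by
    induction hg with
    | id => rfl
    | comp hf _ ih =>
      rw [Function.comp_apply, ih]
      rcases hf with ⟨a, rfl⟩ | ⟨T, -, rfl⟩ <;> exact act_empty l _
  have key : (∃ u : List α, ∀ X y, y ∈ g X ↔ ∃ x ∈ X, ∃ ρ, Run l x.1 y.1 u ρ) ∨
      (∃ Y, ∀ X, g X = ∅ ∨ g X = Y) := by
    clear hg0
    induction hg with
    | id =>
      refine Or.inl ⟨[], fun X y => ?_⟩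
      simp only [exists_run_nil, id]
      exact ⟨fun h => ⟨y, h, rfl⟩, fun ⟨x, hx, h⟩ => Subtype.ext h ▸ hx⟩
    | @comp f g hf _ ih =>
      rcases hf with ⟨a, rfl⟩ | ⟨T, hT, rfl⟩
      · rcases ih with ⟨u, ih⟩ | ⟨Y, ih⟩
        · refine Or.inl ⟨u ++ [a], fun X y => ?_⟩
          simp only [exists_run_append]
          constructor
          · rintro ⟨δ, hδ, hδl, ⟨z, hz, hzδ⟩, hy⟩
            obtain ⟨x, hx, ρ, hρ⟩ := (ih X z).1 hz
            exact ⟨x, hx, z.1, ⟨ρ, hρ⟩, [δ], by simpa using hδl, ⟨hzδ.symm, hy.symm⟩,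
              by simpa using hδ⟩
          · rintro ⟨x, hx, s, hρ, ρ', h1, h2, h3⟩
            obtain ⟨δ, rfl, hδ⟩ := List.map_eq_singleton_iff.1 h3
            have hδl := h1 δ (by simp)
            obtain ⟨rfl, h4⟩ := h2
            exact ⟨δ, hδ, hδl, ⟨⟨δ.1, src_mem_states hδl⟩, (ih X _).2 ⟨x, hx, hρ⟩, rfl⟩,
              Eq.symm h4⟩
        · refine Or.inr ⟨act l {δ | δ.2.1 = a} Y, fun X => ?_⟩
          rcases ih X with h | h
          · exact Or.inl (by rw [Function.comp_apply, h, act_empty])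
          · exact Or.inr (by rw [Function.comp_apply, h])
      · refine Or.inr ⟨{y | ∃ δ ∈ T, δ ∈ l ∧ y.1 = δ.2.2.1}, fun X => ?_⟩
        rw [or_iff_not_imp_left]
        intro hne
        obtain ⟨y, δ, hδ, hδl, hx, hy⟩ := Set.nonempty_iff_ne_empty.2 hne
        ext y'
        constructor
        · rintro ⟨δ', hδ', hδl', hx', hy'⟩
          exact ⟨δ', hδ', hδl', hy'⟩
        · rintro ⟨δ', hδ', hδl', hy'⟩
          obtain rfl := hT hδ hδ'
          exact ⟨δ, hδ, hδl, hx, hy'⟩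
  intro X
  rcases key with ⟨u, hu⟩ | ⟨Y, hY⟩
  · by_cases hu0 : u = []
    · subst hu0
      refine ⟨0, ?_⟩
      ext y
      simp only [Function.iterate_succ, Function.iterate_zero, Function.comp_apply, id, hu,
        exists_run_nil]
      exact ⟨fun h => ⟨y, h, rfl⟩, fun ⟨x, hx, h⟩ => Subtype.ext h ▸ hx⟩
    · have hit : ∀ m X y, y ∈ g^[m] X ↔
          ∃ x ∈ X, ∃ ρ, Run l x.1 y.1 (List.replicate m u).flatten ρ := by
        intro m X
        induction m with
        | zero =>
          intro y
          simp only [Function.iterate_zero, id, List.replicate_zero, List.flatten_nil,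
            exists_run_nil]
          exact ⟨fun h => ⟨y, h, rfl⟩, fun ⟨x, hx, h⟩ => Subtype.ext h ▸ hx⟩
        | succ m ih =>
          intro y
          rw [Function.iterate_succ_apply', hu, List.replicate_succ', List.flatten_append]
          simp only [List.flatten_singleton, exists_run_append, ih]
          constructor
          · rintro ⟨z, ⟨x, hx, h1⟩, h2⟩
            exact ⟨x, hx, z.1, h1, h2⟩
          · rintro ⟨x, hx, s, h1, ρ, h2⟩
            exact ⟨⟨s, h2.source_mem hu0⟩, ⟨x, hx, h1⟩, ρ, h2⟩
      obtain ⟨m, hm⟩ := hl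
      refine ⟨m, ?_⟩
      ext y
      simp only [hit, hm _ _ u hu0]
  -- As `∅` is fixed and `Y` is the only possible nonempty value, the orbit of `X` is stationary
  -- after at most two steps.
  · rcases hY X with h | h
    · exact ⟨1, by simp [h, hg0]⟩
    · rcases hY Y with h' | h'
      · exact ⟨2, by simp [h, h', hg0]⟩
      · exact ⟨1, by simp [h, h']⟩

/-- The rank that suffices for runs with transitions from `l`. -/
def runRank (l : List (Edge α R)) : ℕ := cfRank (2 ^ (2 * l.length)) + 1

/-- Equivalent words with distinguished positions have runs with the same transitions at these
positions. -/
theorem exists_run_of_WEF {l : List (Edge α R)} (hl : EdgesAperiodic l) {u v : List α}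
    (hu : u ≠ []) {t t' : List ℕ} {e : List (Edge α R)} (ht : t.length = t'.length)
    (het : e.length = t.length) (ht' : ∀ y ∈ t', y < v.length)
    (h : WEF (runRank l) u v (zipSet t t')) {p q : ℕ} {ρ : List (Edge α R)} (hρ : Run l p q u ρ)
    (hρt : ∀ i < e.length, ρ[t.getD i 0]? = e[i]?) :
    ∃ ρ', Run l p q v ρ' ∧ ∀ i < e.length, ρ'[t'.getD i 0]? = e[i]? := by
  -- The transitions allowed at `x` have the right letter and respect every prescription of `e` at
  -- `x`. At a distinguished position at most one remains, elsewhere all those with the letter, so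
  -- the action is always in `actions l`.
  set T : List α → List ℕ → ℕ → Set (Edge α R) := fun w s x =>
    {δ | some δ.2.1 = wlab w x ∧ ∀ j < e.length, s.getD j 0 = x → some δ = e[j]?} with hT
  have hTact : ∀ (w : List α) (s : List ℕ), ∀ x ∈ wpos w, act l (T w s x) ∈ actions l := by
    intro w s x hx
    by_cases hj : ∃ j < e.length, s.getD j 0 = x
    · obtain ⟨j, hj, hjx⟩ := hj
      refine Or.inr ⟨_, ?_, rfl⟩
      intro δ hδ δ' hδ'
      have := (hδ.2 j hj hjx).trans (hδ'.2 j hj hjx).symm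
      simpa using this
    · refine Or.inl ⟨w[x]'hx, ?_⟩
      congr 1
      ext δ
      have hx' : wlab w x = some (w[x]'hx) := List.getElem?_eq_getElem hx
      simp only [hT, Set.mem_ofPred_eq, hx', Option.some.injEq]
      exact ⟨fun h => h.1, fun h => ⟨h, fun j hj' hjx => absurd ⟨j, hj', hjx⟩ hj⟩⟩
  -- The action at `x` depends on its letter and on which distinguished positions equal `x`. A
  -- partial isomorphism preserves both, so the relabelling costs no rounds.
  have hEF : EF (wpos u) (fun x => act l (T u t x)) (wpos v) (fun x => act l (T v t' x))
      (cfRank (2 ^ (2 * l.length))) ∅ := by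
    refine EF.interp (r := 0) subset_rfl subset_rfl (h.of_le (by simp [runRank])) ?_
      (Set.empty_subset _) (by simp)
    intro s hs hs0 x hx y hy hxy
    refine ⟨⟨fun _ => hy, fun _ => hx⟩, fun _ _ => ?_⟩
    have hlab : wlab u x = wlab v y := (hs0.piso _ hxy).1
    have heq : ∀ j < e.length, t.getD j 0 = x ↔ t'.getD j 0 = y := fun j hj =>
      hs0.piso.eq_iff (hs ((mem_zipSet_iff ht).2 ⟨j, by omega, rfl⟩)) hxy
    congr 1
    ext δ
    simp only [hT, Set.mem_ofPred_eq, hlab]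
    refine and_congr Iff.rfl (forall₂_congr fun j hj => ?_)
    rw [heq j hj]
  have hev := ev_eq_of_EF (P := wpos u) (P' := wpos v) _ (actions l)
    (show Nat.card (Set (State l)) ≤ 2 ^ (2 * l.length) by
      have := Fintype.ofFinite (State l)
      classical
      rw [Nat.card_eq_fintype_card, Fintype.card_set, ← Nat.card_eq_fintype_card]
      exact Nat.pow_le_pow_right (by omega) (card_state_le l))
    (counterFree_actions hl) (fun x hx => hx) (fun x hx => hx) (hTact u t) (hTact v t') hEF
  have hq : (⟨q, hρ.target_mem hu⟩ : State l) ∈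
      ev (wpos u) (fun x => act l (T u t x)) u.length {⟨p, hρ.source_mem hu⟩} := by
    refine (mem_ev_act (fun i hi => hi) _ _).2 ⟨ρ, hρ.length_eq, hρ.1, ⟨_, rfl, hρ.2.1⟩, ?_⟩
    intro i δ hi
    refine ⟨?_, fun j hj hji => ?_⟩
    · rw [← hρ.2.2, wlab, List.getElem?_map, hi]
      rfl
    · rw [← hρt j hj, hji, hi]
  rw [hev] at hq
  obtain ⟨ρ', h1, h2, ⟨x, rfl, h3⟩, h4⟩ := (mem_ev_act (fun i hi => hi) _ _).1 hq
  refine ⟨ρ', ⟨h2, h3, ?_⟩, fun i hi => ?_⟩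
  · refine List.ext_getElem? fun i => ?_
    rw [List.getElem?_map]
    rcases hi : ρ'[i]? with _ | δ
    · rw [List.getElem?_eq_none_iff] at hi
      rw [Option.map_none, List.getElem?_eq_none (by omega)]
    · exact (h4 i δ hi).1
  · have hlt : t'.getD i 0 < ρ'.length := by
      rw [h1]
      exact ht' _ (by rw [List.getD_eq_getElem _ _ (show i < t'.length by omega)]; simp)
    have := (h4 _ _ (List.getElem?_eq_getElem hlt)).2 i hi rfl
    rw [List.getElem?_eq_getElem hlt, this]

end Edges

/-! ### Enumeration of sequences -/

/-- All lists of length `m` with entries from `L`. -/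
def tuples {β : Type*} (L : List β) : ℕ → List (List β)
  | 0 => [[]]
  | m + 1 => (tuples L m).flatMap fun t => L.map fun x => t ++ [x]

theorem mem_tuples {β : Type*} {L : List β} {m : ℕ} {t : List β} :
    t ∈ tuples L m ↔ t.length = m ∧ ∀ x ∈ t, x ∈ L := by
  induction m generalizing t with
  | zero =>
    simp only [tuples, List.mem_singleton, List.length_eq_zero_iff]
    exact ⟨fun h => ⟨h, by simp [h]⟩, fun h => h.1⟩
  | succ m ih =>
    simp only [tuples, List.mem_flatMap, List.mem_map, ih]
    constructor
    · rintro ⟨s, ⟨h1, h2⟩, x, hx, rfl⟩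
      refine ⟨by simp [h1], fun y hy => ?_⟩
      rcases List.mem_append.1 hy with h | h
      exacts [h2 y h, List.mem_singleton.1 h ▸ hx]
    · rintro ⟨h1, h2⟩
      rcases List.eq_nil_or_concat t with rfl | ⟨s, x, rfl⟩
      · simp at h1
      · rw [List.concat_eq_append] at *
        exact ⟨s, ⟨by simpa using h1, fun y hy => h2 y (by simp [hy])⟩, x, h2 x (by simp), rfl⟩

theorem nodup_tuples {β : Type*} {L : List β} (hL : L.Nodup) (m : ℕ) : (tuples L m).Nodup := by
  induction m with
  | zero => simp [tuples]
  | succ m ih =>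
    refine List.nodup_flatMap.2 ⟨fun t _ => hL.map fun x y h => by simpa using h, ?_⟩
    refine ih.imp fun {s t} hst => ?_
    intro z hs ht
    obtain ⟨x, _, rfl⟩ := List.mem_map.1 hs
    obtain ⟨y, _, h⟩ := List.mem_map.1 ht
    exact hst (List.append_inj_left' h rfl).symm

/-- All lists of length less than `N` with entries from `L`. -/
def seqs {β : Type*} (L : List β) (N : ℕ) : List (List β) := (List.range N).flatMap (tuples L)

theorem mem_seqs {β : Type*} {L : List β} {N : ℕ} {t : List β} :
    t ∈ seqs L N ↔ t.length < N ∧ ∀ x ∈ t, x ∈ L := by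
  simp [seqs, mem_tuples]

/-! ### Component heights and the canonical positions of a run -/

section Heights

variable {α R : Type*}

/-- One step of reading a path. -/
def stepState (s : Option ℕ) (δ : Edge α R) : Option ℕ :=
  if s = some δ.1 then some δ.2.2.1 else none

/-- The end of the path `ρ` from `p`, if it is one. -/
def pathEnd (p : ℕ) (ρ : List (Edge α R)) : Option ℕ := ρ.foldl stepState (some p)

theorem pathEnd_eq_some {p q : ℕ} {ρ : List (Edge α R)} : pathEnd p ρ = some q ↔ Path p q ρ := by
  have hnone : ∀ ρ : List (Edge α R), ρ.foldl stepState none = none := by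
    intro ρ
    induction ρ with
    | nil => rfl
    | cons δ ρ ih => simpa [stepState] using ih
  induction ρ generalizing p with
  | nil => simp [pathEnd, Path]
  | cons δ ρ ih =>
    by_cases h : δ.1 = p
    · rw [pathEnd, List.foldl_cons, stepState, if_pos (by rw [h])]
      exact ih.trans (by simp [Path, h])
    · rw [Path, pathEnd, List.foldl_cons, stepState,
        if_neg (fun h' => h (Option.some.inj h').symm), hnone]
      simp [h]

/-- There is a path of length less than `N`. -/
def Reach (N : ℕ) (l : List (Edge α R)) (x y : ℕ) : Prop := ∃ ρ ∈ seqs l N, pathEnd x ρ = some y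

open Classical in
/-- The number of transitions that cannot be reached. -/
noncomputable def height (N : ℕ) (l : List (Edge α R)) (x : ℕ) : ℕ :=
  (l.filter fun δ => ¬ Reach N l x δ.1).length

/-- `h` increases weakly along transitions, and strictly between different components. -/
structure IsHeight (l : List (Edge α R)) (h : ℕ → ℕ) : Prop where
  le : ∀ δ ∈ l, h δ.1 ≤ h δ.2.2.1
  back : ∀ δ ∈ l, h δ.1 = h δ.2.2.1 → ∃ u ρ, Run l δ.2.2.1 δ.1 u ρ
  bdd : ∀ x, h x ≤ l.length

/-- A transition `δ` at position `x` of a run of length `n` is the first one with a target of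
height greater than `i`, or the last one. -/
def Canon (h : ℕ → ℕ) (n i x : ℕ) (δ : Edge α R) : Prop :=
  (i < h δ.2.2.1 ∨ x + 1 = n) ∧ (x = 0 ∨ h δ.1 ≤ i)

/-- The transitions of `ρ` at the positions `t` are those in `e`, and the first `J` of them are
at the canonical positions. -/
def Match (h : ℕ → ℕ) (J : ℕ) (ρ : List (Edge α R)) (t : List ℕ) (e : List (Edge α R)) : Prop :=
  (∀ i < e.length, ρ[t.getD i 0]? = e[i]?) ∧
    ∀ i < J, ∀ δ ∈ e, e[i]? = some δ → Canon h ρ.length i (t.getD i 0) δ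

theorem Path.getElem_succ {p q : ℕ} {ρ : List (Edge α R)} (hρ : Path p q ρ) {i : ℕ}
    (hi : i + 1 < ρ.length) : ρ[i].2.2.1 = ρ[i + 1].1 := by
  induction ρ generalizing p i with
  | nil => simp at hi
  | cons δ ρ ih =>
    cases i with
    | zero =>
      cases ρ with
      | nil => simp at hi
      | cons δ' ρ => exact (hρ.2.1).symm
    | succ i => simpa using ih hρ.2 (by simpa using hi)

variable {l : List (Edge α R)} {h : ℕ → ℕ}

theorem IsHeight.le_of_lt (hh : IsHeight l h) {p q : ℕ} {ρ : List (Edge α R)} (hρ : Path p q ρ)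
    (hρl : ∀ δ ∈ ρ, δ ∈ l) {i j : ℕ} (hij : i < j) (hj : j < ρ.length) :
    h ρ[i].2.2.1 ≤ h ρ[j].1 := by
  induction j, hij using Nat.le_induction with
  | base => rw [hρ.getElem_succ hj]
  | succ j hij ih =>
    rw [← hρ.getElem_succ hj]
    exact (ih (by omega)).trans (hh.le _ (hρl _ (List.getElem_mem _)))

/-- Take the least position whose target is above level `i`, or which is the last one. By minimality
the preceding target, which is the source here, is not above level `i`. -/
theorem Path.exists_canon {p q : ℕ} {ρ : List (Edge α R)} (hρ : Path p q ρ) (h : ℕ → ℕ)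
    (hne : 0 < ρ.length) (i : ℕ) :
    ∃ (x : ℕ) (hx : x < ρ.length), Canon h ρ.length i x ρ[x] := by
  classical
  have hex : ∃ x, ∃ hx : x < ρ.length, i < h ρ[x].2.2.1 ∨ x + 1 = ρ.length :=
    ⟨ρ.length - 1, by omega, Or.inr (by omega)⟩
  obtain ⟨hx, hx'⟩ := Nat.find_spec hex
  refine ⟨Nat.find hex, hx, hx', ?_⟩
  by_contra hcon
  push Not at hcon
  obtain ⟨h0, h1⟩ := hcon
  obtain ⟨y, hy⟩ := Nat.exists_eq_succ_of_ne_zero h0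
  have hmin := Nat.find_min hex (m := y) (by omega)
  refine hmin ⟨by omega, Or.inl ?_⟩
  have := hρ.getElem_succ (i := y) (by omega)
  rw [this]
  simpa [hy] using h1

/-- Heights never decrease along a run: once a target is above level `i`, no later source has height
at most `i`. -/
theorem IsHeight.canon_unique (hh : IsHeight l h) {p q : ℕ} {ρ : List (Edge α R)}
    (hρ : Path p q ρ) (hρl : ∀ δ ∈ ρ, δ ∈ l) {i x y : ℕ} (hx : x < ρ.length) (hy : y < ρ.length)
    (h1 : Canon h ρ.length i x ρ[x]) (h2 : Canon h ρ.length i y ρ[y]) : x = y := by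
  have key : ∀ {x y : ℕ} (hx : x < ρ.length) (hy : y < ρ.length),
      Canon h ρ.length i x ρ[x] → Canon h ρ.length i y ρ[y] → ¬ x < y := by
    intro x y hx hy h1 h2 hxy
    have h3 := hh.le_of_lt hρ hρl hxy hy
    rcases h1.1 with h4 | h4 <;> rcases h2.2 with h5 | h5 <;> omega
  exact le_antisymm (not_lt.1 (key hy hx h2 h1)) (not_lt.1 (key hx hy h1 h2))

/-- A transition that changes the component is at a canonical position. -/
theorem IsHeight.canon_of_ne (hh : IsHeight l h) {δ : Edge α R} (hδ : δ ∈ l) (n x : ℕ)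
    (hne : h δ.1 ≠ h δ.2.2.1) : h δ.1 < l.length ∧ Canon h n (h δ.1) x δ := by
  have h1 := hh.le δ hδ
  have h2 := hh.bdd δ.2.2.1
  exact ⟨by omega, Or.inl (by omega), Or.inr le_rfl⟩

theorem IsHeight.exists_back (hh : IsHeight l h) {p q : ℕ} {ρ : List (Edge α R)}
    (hρ : Path p q ρ) (hρl : ∀ δ ∈ ρ, δ ∈ l ∧ h δ.1 = h δ.2.2.1) : ∃ u ρ', Run l q p u ρ' := by
  induction ρ generalizing p with
  | nil =>
    obtain rfl : p = q := hρ
    exact ⟨[], exists_run_nil.2 rfl⟩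
  | cons δ ρ ih =>
    obtain ⟨rfl, h2⟩ := hρ
    obtain ⟨u, hu⟩ := ih h2 fun δ' h' => hρl δ' (by simp [h'])
    obtain ⟨v, hv⟩ := hh.back δ (hρl δ (by simp)).1 (hρl δ (by simp)).2
    exact ⟨u ++ v, exists_run_append.2 ⟨_, hu, hv⟩⟩

/-- Two runs with the same label agree, if they agree whenever one of them changes the
component. -/
theorem IsHeight.run_eq (hh : IsHeight l h) (hl : EdgesUnambiguous l) {p q : ℕ} {u : List α}
    {ρ ρ' : List (Edge α R)} (hρ : Run l p q u ρ) (hρ' : Run l p q u ρ')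
    (H : ∀ (i : ℕ) (δ δ' : Edge α R), ρ[i]? = some δ → ρ'[i]? = some δ' →
      δ = δ' ∨ h δ.1 = h δ.2.2.1) : ρ = ρ' := by
  induction hn : ρ.length using Nat.strong_induction_on generalizing p q u ρ ρ' with
  | _ n ih =>
    subst hn
    have hlen : ρ.length = ρ'.length := by rw [hρ.length_eq, hρ'.length_eq]
    -- Split at a common transition and recurse on both sides. If the runs agree nowhere, no
    -- transition of `ρ` changes the height, so `p` is reachable from `q` and unambiguity applies.
    by_cases hex : ∃ (i : ℕ) (hi : i < ρ.length), ρ[i] = ρ'[i]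
    · obtain ⟨i, hi, hii⟩ := hex
      obtain ⟨ρ₁, δ, ρ₂, rfl, hi₁⟩ : ∃ ρ₁ δ ρ₂, ρ = ρ₁ ++ δ :: ρ₂ ∧ ρ₁.length = i :=
        ⟨ρ.take i, ρ[i], ρ.drop (i + 1), by simp, by simp; omega⟩
      obtain ⟨ρ₁', δ', ρ₂', rfl, hi₁'⟩ : ∃ ρ₁ δ ρ₂, ρ' = ρ₁ ++ δ :: ρ₂ ∧ ρ₁.length = i :=
        ⟨ρ'.take i, ρ'[i], ρ'.drop (i + 1), by simp, by simp; omega⟩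
      obtain rfl : δ = δ' := by
        subst hi₁
        simpa [List.getElem_append, hi₁'] using hii
      obtain ⟨h1, h2, h3⟩ := hρ
      obtain ⟨h1', h2', h3'⟩ := hρ'
      obtain ⟨s, h4, rfl, h5⟩ := path_append.1 h2
      obtain ⟨s', h4', rfl, h5'⟩ := path_append.1 h2'
      rw [← h3'] at h3
      simp only [List.map_append, List.map_cons] at h3
      obtain ⟨h6, h7⟩ := List.append_inj h3 (by simp [hi₁, hi₁'])
      have e1 : ρ₁ = ρ₁' := by
        refine ih ρ₁.length (by simp) ⟨fun δ hδ => h1 δ (by simp [hδ]), h4, rfl⟩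
          ⟨fun δ hδ => h1' δ (by simp [hδ]), h4', h6.symm⟩ ?_ rfl
        intro j δ₁ δ₂ hj hj'
        refine H j δ₁ δ₂ ?_ ?_
        · rw [List.getElem?_append_left (List.getElem?_eq_some_iff.1 hj).1, hj]
        · rw [List.getElem?_append_left (List.getElem?_eq_some_iff.1 hj').1, hj']
      have e2 : ρ₂ = ρ₂' := by
        refine ih ρ₂.length (by simp; omega) ⟨fun δ hδ => h1 δ (by simp [hδ]), h5, rfl⟩
          ⟨fun δ hδ => h1' δ (by simp [hδ]), h5', (List.cons_inj_right _).1 h7.symm⟩ ?_ rfl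
        intro j δ₁ δ₂ hj hj'
        refine H (i + 1 + j) δ₁ δ₂ ?_ ?_
        · rw [List.getElem?_append_right (by omega), hi₁,
            show i + 1 + j - i = j + 1 by omega, List.getElem?_cons_succ, hj]
        · rw [List.getElem?_append_right (by omega), hi₁',
            show i + 1 + j - i = j + 1 by omega, List.getElem?_cons_succ, hj']
      rw [e1, e2]
    · refine hl p q ⟨u, ρ, hρ⟩ (hh.exists_back hρ.2.1 fun δ hδ => ⟨hρ.1 δ hδ, ?_⟩) u ρ ρ' hρ hρ'
      obtain ⟨i, hi, rfl⟩ := List.mem_iff_getElem.1 hδ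
      refine (H i ρ[i] ρ'[i] (List.getElem?_eq_getElem _) (List.getElem?_eq_getElem _)).resolve_left
        fun h' => hex ⟨i, hi, h'⟩

/-- A run is determined by its transitions at the canonical positions. -/
theorem IsHeight.match_unique (hh : IsHeight l h) (hl : EdgesUnambiguous l) {p q : ℕ} {u : List α}
    {ρ ρ' : List (Edge α R)} (hρ : Run l p q u ρ) (hρ' : Run l p q u ρ') {t : List ℕ}
    {e : List (Edge α R)} (he : l.length ≤ e.length) (hm : Match h l.length ρ t e)
    (hm' : Match h l.length ρ' t e) : ρ = ρ' := by
  refine hh.run_eq hl hρ hρ' fun x δ δ' hx hx' => ?_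
  by_contra hcon
  push Not at hcon
  obtain ⟨h1, h2⟩ := hcon
  obtain ⟨hxl, hxδ⟩ := List.getElem?_eq_some_iff.1 hx
  obtain ⟨h3, h4⟩ := hh.canon_of_ne (hρ.1 δ (List.mem_of_getElem? hx)) ρ.length x h2
  have hi : h δ.1 < e.length := by omega
  have h5 := hm.1 _ hi
  rw [List.getElem?_eq_getElem hi] at h5
  obtain ⟨h6, h7⟩ := List.getElem?_eq_some_iff.1 h5
  have h8 := hm.2 _ h3 _ (List.getElem_mem _) (List.getElem?_eq_getElem hi)
  -- In `ρ` the canonical position of level `h δ.1` is `x`, so this is the entry of `t` at that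
  -- index, and `e` prescribes the same transition there to both runs.
  have h9 := hh.canon_unique hρ.2.1 hρ.1 (i := h δ.1) hxl h6 (by rw [hxδ]; exact h4)
    (by rw [h7]; exact h8)
  have h10 := hm'.1 _ hi
  rw [← h9, hx', ← hm.1 _ hi, ← h9, hx] at h10
  exact h1 (Option.some.inj h10).symm

theorem Run.exists_match {p q : ℕ} {u : List α} {ρ : List (Edge α R)} (hρ : Run l p q u ρ)
    (hu : u ≠ []) (h : ℕ → ℕ) :
    ∃ t ∈ tuples (List.range u.length) l.length, ∃ e ∈ tuples l l.length,
      Match h l.length ρ t e := by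
  have hlen := hρ.length_eq
  have hpos : 0 < ρ.length := hlen ▸ List.length_pos_of_ne_nil hu
  choose x hx hc using hρ.2.1.exists_canon h hpos
  refine ⟨(List.range l.length).map x, mem_tuples.2 ⟨by simp, ?_⟩,
    (List.range l.length).map fun i => ρ[x i]'(hx i), mem_tuples.2 ⟨by simp, ?_⟩, ?_, ?_⟩
  · simpa [← hlen] using fun i _ => hx i
  · intro δ hδ
    obtain ⟨i, _, rfl⟩ := List.mem_map.1 hδ
    exact hρ.1 _ (List.getElem_mem _)
  · intro i hi
    have hi' : i < l.length := by simpa using hi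
    simp [hi', hx i]
  · intro i hi δ _ hδ
    simp [hi] at hδ
    subst hδ
    simpa [hi] using hc i

/-- This prevents overcounting: in the final sum each run contributes for a single choice of
positions and transitions. -/
theorem IsHeight.match_positions_unique (hh : IsHeight l h) {p q : ℕ} {u : List α}
    {ρ : List (Edge α R)} (hρ : Run l p q u ρ) {t t' : List ℕ} {e e' : List (Edge α R)}
    (ht : t.length = l.length) (ht' : t'.length = l.length) (he : e.length = l.length)
    (he' : e'.length = l.length) (hm : Match h l.length ρ t e) (hm' : Match h l.length ρ t' e') :
    t = t' ∧ e = e' := by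
  have key : ∀ i < l.length, t.getD i 0 = t'.getD i 0 := by
    intro i hi
    have h1 := hm.1 i (by omega)
    have h1' := hm'.1 i (by omega)
    rw [List.getElem?_eq_getElem (show i < e.length by omega)] at h1
    rw [List.getElem?_eq_getElem (show i < e'.length by omega)] at h1'
    obtain ⟨h2, h3⟩ := List.getElem?_eq_some_iff.1 h1
    obtain ⟨h2', h3'⟩ := List.getElem?_eq_some_iff.1 h1'
    exact hh.canon_unique hρ.2.1 hρ.1 h2 h2'
      (h3 ▸ hm.2 i hi _ (List.getElem_mem _) (List.getElem?_eq_getElem (by omega)))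
      (h3' ▸ hm'.2 i hi _ (List.getElem_mem _) (List.getElem?_eq_getElem (by omega)))
  constructor
  · refine List.ext_getElem (by omega) fun i h1 h2 => ?_
    simpa [List.getD_eq_getElem?_getD, h1, h2] using key i (by omega)
  · refine List.ext_getElem? fun i => ?_
    by_cases hi : i < l.length
    · rw [← hm.1 i (by omega), ← hm'.1 i (by omega), key i hi]
    · rw [List.getElem?_eq_none (by omega), List.getElem?_eq_none (by omega)]

/-! ### Short runs and heights -/

/-- A bound for the length of the shortest equivalent words; `b` is the number of letters. -/
def shortBound (b : ℕ) (l : List (Edge α R)) : ℕ :=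
  tyBound b (runRank l + (l.length + 1)) (runRank l + (l.length + 1))

/-- The rank in `shortBound` has `l.length + 1` rounds to spare for moving positions: one for each
canonical position, and one for the position whose weight is asked for. -/
theorem exists_short_points [Fintype α] (l : List (Edge α R)) (u : List α) {t : List ℕ}
    (ht : ∀ x ∈ t, x < u.length) (htl : t.length ≤ l.length + 1) :
    ∃ (v : List α) (t' : List ℕ), v.length < shortBound (Fintype.card α) l ∧
      t'.length = t.length ∧ (∀ y ∈ t', y < v.length) ∧ WEF (runRank l) u v (zipSet t t') := by
  obtain ⟨v, hv, h1⟩ := exists_short_WEF (runRank l + (l.length + 1)) u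
  obtain ⟨t', h2, h3, h4⟩ := EF.play (k := runRank l) t (h1.of_le (by omega)) ht
  exact ⟨v, t', hv, h2, h3, by simpa using h4⟩

theorem WEF.one_nonempty {k : ℕ} {u v : List α} {s : Set (ℕ × ℕ)} (h : WEF k u v s) (hk : 1 ≤ k)
    (hu : u ≠ []) : v ≠ [] := by
  obtain ⟨y, hy, _⟩ := (h.of_le hk).2.1 0 (List.length_pos_of_ne_nil hu)
  exact List.ne_nil_of_length_pos (Nat.zero_lt_of_lt hy)

/-- With one round left the spoiler can exhibit a position before or after `y`. The `+ 1` in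
`runRank` provides this round, as `Canon` refers to the first and last positions. -/
theorem WEF.ends {k : ℕ} {u v : List α} {s : Set (ℕ × ℕ)} (h : WEF k u v s) (hk : 1 ≤ k) {x y : ℕ}
    (hxy : (x, y) ∈ s) (hy : y < v.length) :
    (x = 0 → y = 0) ∧ (x + 1 = u.length → y + 1 = v.length) := by
  have h1 := (h.of_le hk).2.2
  constructor
  · intro hx0
    by_contra hy0
    obtain ⟨x', hx', h2⟩ := h1 0 (show 0 < v.length by omega)
    have := (h2.piso.lt_iff (Set.mem_insert _ _) (Set.mem_insert_of_mem _ hxy)).2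
      (show 0 < y by omega)
    dsimp only at this
    omega
  · intro hxl
    by_contra hyl
    obtain ⟨x', hx', h2⟩ := h1 (y + 1) (show y + 1 < v.length by omega)
    have := (h2.piso.lt_iff (Set.mem_insert_of_mem _ hxy) (Set.mem_insert _ _)).2
      (show y < y + 1 by omega)
    have hx'' : x' < u.length := hx'
    dsimp only at this
    omega

/-- Whether a prescribed transition is canonical depends only on the level, on the transition, and
on its position being first or last; `WEF.ends` transfers the latter. -/
theorem exists_match_of_WEF (hl : EdgesAperiodic l) {u v : List α}
    (hu : u ≠ []) {t t' : List ℕ} {e : List (Edge α R)} (ht : t.length = t'.length)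
    (het : e.length = t.length) (htv : ∀ y ∈ t', y < v.length)
    (hEF : WEF (runRank l) u v (zipSet t t')) {p q J : ℕ} {ρ : List (Edge α R)}
    (hρ : Run l p q u ρ) (hm : Match h J ρ t e) : ∃ ρ', Run l p q v ρ' ∧ Match h J ρ' t' e := by
  obtain ⟨ρ', h1, h2⟩ := exists_run_of_WEF hl hu ht het htv hEF hρ hm.1
  refine ⟨ρ', h1, h2, fun i hi δ hδ hiδ => ?_⟩
  obtain ⟨h3, h4⟩ := hm.2 i hi δ hδ hiδ
  have hie : i < e.length := (List.getElem?_eq_some_iff.1 hiδ).1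
  have hends := hEF.ends (by simp [runRank])
    ((mem_zipSet_iff ht).2 ⟨i, by omega, rfl⟩)
    (htv _ (by rw [List.getD_eq_getElem _ _ (show i < t'.length by omega)]; simp))
  rw [hρ.length_eq] at h3
  rw [Canon, h1.length_eq]
  exact ⟨h3.imp id hends.2, h4.imp hends.1 id⟩

/-- Searching among short paths makes reachability, and hence the height, computable. Nothing is
lost, since a run on a word yields one on a short equivalent word with the same end points. -/
theorem reach_iff [Fintype α] (hl : EdgesAperiodic l) {x y : ℕ} :
    Reach (shortBound (Fintype.card α) l) l x y ↔ ∃ u ρ, Run l x y u ρ := by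
  simp only [Reach, mem_seqs, pathEnd_eq_some]
  constructor
  · rintro ⟨ρ, ⟨_, h1⟩, h2⟩
    exact ⟨_, ρ, h1, h2, rfl⟩
  · rintro ⟨u, ρ, hρ⟩
    obtain ⟨v, t', h1, h2, -, h3⟩ := exists_short_points l u (t := []) (by simp) (by simp)
    by_cases hu : u = []
    · subst hu
      refine ⟨[], ⟨by simp; omega, by simp⟩, exists_run_nil.1 ⟨ρ, hρ⟩⟩
    · obtain ⟨ρ', h4, -⟩ := exists_run_of_WEF hl hu (t := []) (t' := t') (e := [])
        (by simpa using h2.symm) rfl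
        (by rw [List.length_eq_zero_iff.1 h2]; simp) h3 hρ (by simp)
      exact ⟨ρ', ⟨h4.length_eq ▸ h1, h4.1⟩, h4.2.1⟩

/-- Whatever the target of a transition reaches, its source reaches too, so the list of unreached
transitions can only grow. If its length is unchanged, so is the list. The transition itself is not
in it at the source, hence not at the target either, which therefore reaches the source. -/
theorem isHeight_height [Fintype α] (hl : EdgesAperiodic l) :
    IsHeight l (height (shortBound (Fintype.card α) l) l) := by
  classical
  have hstep : ∀ δ ∈ l, ∃ u ρ, Run l δ.1 δ.2.2.1 u ρ := fun δ hδ =>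
    ⟨[δ.2.1], [δ], by simpa using hδ, ⟨rfl, rfl⟩, rfl⟩
  have hsub : ∀ δ ∈ l, ∀ δ' : Edge α R, (∃ u ρ, Run l δ.2.2.1 δ'.1 u ρ) →
      ∃ u ρ, Run l δ.1 δ'.1 u ρ := by
    rintro δ hδ δ' ⟨u, hu⟩
    obtain ⟨v, hv⟩ := hstep δ hδ
    exact ⟨v ++ u, exists_run_append.2 ⟨_, hv, hu⟩⟩
  refine ⟨fun δ hδ => ?_, fun δ hδ heq => ?_, fun x => List.length_filter_le _ _⟩
  · refine (List.monotone_filter_right l fun δ' h' => ?_).length_le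
    simp only [decide_eq_true_eq, reach_iff hl] at h' ⊢
    exact fun h'' => h' (hsub δ hδ δ' h'')
  · have hs : (l.filter fun δ' => decide (¬ Reach (shortBound (Fintype.card α) l) l δ.1 δ'.1)).Sublist
        (l.filter fun δ' => decide (¬ Reach (shortBound (Fintype.card α) l) l δ.2.2.1 δ'.1)) := by
      refine List.monotone_filter_right l fun δ' h' => ?_
      simp only [decide_eq_true_eq, reach_iff hl] at h' ⊢
      exact fun h'' => h' (hsub δ hδ δ' h'')
    have hfe := hs.eq_of_length (by
      unfold height at heq
      convert heq using 3)
    by_contra hcon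
    have h1 : δ ∈ l.filter fun δ' =>
        decide (¬ Reach (shortBound (Fintype.card α) l) l δ.2.2.1 δ'.1) := by
      rw [List.mem_filter]
      exact ⟨hδ, by simpa only [decide_eq_true_eq, reach_iff hl] using hcon⟩
    rw [← hfe, List.mem_filter] at h1
    have h2 := h1.2
    simp only [decide_eq_true_eq, reach_iff hl] at h2
    exact h2 ⟨[], exists_run_nil.2 rfl⟩

end Heights

/-! ### The formulas -/

section Formulas

variable {α R : Type*}

/-- `ρ` is a nonempty path from `p` to `q` that matches `t` and `e`. -/
def Witness (b : ℕ) (l : List (Edge α R)) (p q : ℕ) (e : List (Edge α R))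
    (x : List (Edge α R) × List ℕ) : Prop :=
  x.1 ≠ [] ∧ pathEnd p x.1 = some q ∧ Match (height (shortBound b l) l) l.length x.1 x.2 e

/-- All short sequences of transitions with `d` positions. -/
def pointedSeqs (b : ℕ) (l : List (Edge α R)) (d : ℕ) : List (List (Edge α R) × List ℕ) :=
  (seqs l (shortBound b l)).flatMap fun ρ => (tuples (List.range ρ.length) d).map (Prod.mk ρ)

open Classical in
/-- There is a run from `p` to `q` that matches `e` at the positions given by the variables. -/
noncomputable def runFormula (b : ℕ) (l : List (Edge α R)) (p q : ℕ) (e : List (Edge α R)) : FO α :=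
  FO.disj (((pointedSeqs b l e.length).filter fun x => Witness b l p q e x).map fun x =>
    FO.hintikka (x.1.map fun δ => δ.2.1) (runRank l) x.2)

/-- The weight of the transition, at the position given by the last variable, of the run that
matches `e`. -/
noncomputable def weightFormula (b : ℕ) (l : List (Edge α R)) (p q : ℕ) (e : List (Edge α R))
    (r : R) : StepFO α R :=
  l.foldr (fun δ Ψ => StepFO.ite (runFormula b l p q (e ++ [δ])) (StepFO.const δ.2.2.2) Ψ)
    (StepFO.const r)

/-- The sum of a list of formulas. -/
def WFO.sumList : List (WFO α R) → WFO α R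
  | [] => WFO.zero
  | Φ :: L => WFO.add Φ (sumList L)

/-- The sum over the first `j` variables. -/
def WFO.sumVars : ℕ → WFO α R → WFO α R
  | 0, Φ => Φ
  | j + 1, Φ => sumVars j (WFO.sum j Φ)

/-- The runs from `p` to `q` that match `e`. -/
noncomputable def matchFormula (b : ℕ) (l : List (Edge α R)) (p q : ℕ) (e : List (Edge α R))
    (r : R) : WFO α R :=
  WFO.sumVars l.length (WFO.ite (runFormula b l p q e)
    (WFO.prod l.length (weightFormula b l p q e r)) WFO.zero)

/-- The runs from `p` to `q`. -/
noncomputable def pairFormula (b : ℕ) (l : List (Edge α R)) (p q : ℕ) : WFO α R :=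
  l.head?.elim WFO.zero fun d =>
    WFO.sumList ((tuples l l.length).map fun e => matchFormula b l p q e d.2.2.2)

/-! Free variables. -/

theorem fv_runFormula_subset (b : ℕ) (l : List (Edge α R)) (p q : ℕ) (e : List (Edge α R)) :
    (runFormula b l p q e).fv ⊆ {i | i < e.length} := by
  classical
  refine FO.fv_disj_subset fun φ hφ => ?_
  obtain ⟨x, hx, rfl⟩ := List.mem_map.1 hφ
  obtain ⟨ρ, -, hx2⟩ := List.mem_flatMap.1 (List.mem_filter.1 hx).1
  obtain ⟨t, ht, rfl⟩ := List.mem_map.1 hx2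
  rw [← (mem_tuples.1 ht).1]
  exact FO.fv_hintikka_subset _ _ _

theorem fv_weightFormula_subset (b : ℕ) (l : List (Edge α R)) (p q : ℕ) (e : List (Edge α R))
    (r : R) : (weightFormula b l p q e r).fv ⊆ {i | i < e.length + 1} := by
  have key : ∀ L : List (Edge α R), (L.foldr (fun δ Ψ => StepFO.ite (runFormula b l p q (e ++ [δ]))
      (StepFO.const δ.2.2.2) Ψ) (StepFO.const r)).fv ⊆ {i | i < e.length + 1} := by
    intro L
    induction L with
    | nil => simp [StepFO.fv]
    | cons δ L ih =>
      simp only [List.foldr_cons, StepFO.fv, Set.union_subset_iff]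
      refine ⟨⟨?_, by simp⟩, ih⟩
      simpa using fv_runFormula_subset b l p q (e ++ [δ])
  exact key l

theorem WFO.fv_sumVars {j : ℕ} {Φ : WFO α R} (h : Φ.fv ⊆ {i | i < j}) : (sumVars j Φ).fv = ∅ := by
  induction j generalizing Φ with
  | zero => exact Set.subset_empty_iff.1 fun i hi => absurd (h hi) (Nat.not_lt_zero i)
  | succ j ih =>
    refine ih ?_
    rintro i ⟨h1, h2⟩
    have h3 : i < j + 1 := h h1
    have h4 : i ≠ j := h2
    exact show i < j by omega

theorem WFO.fv_sumList {L : List (WFO α R)} (h : ∀ Φ ∈ L, Φ.fv = ∅) : (sumList L).fv = ∅ := by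
  induction L with
  | nil => rfl
  | cons Φ L ih => simp [sumList, WFO.fv, h Φ, ih fun Φ' h' => h Φ' (by simp [h'])]

theorem isSentence_pairFormula (b : ℕ) (l : List (Edge α R)) (p q : ℕ) :
    (pairFormula b l p q).IsSentence := by
  unfold pairFormula WFO.IsSentence
  cases l.head? with
  | none => rfl
  | some d =>
    refine WFO.fv_sumList fun Φ hΦ => ?_
    obtain ⟨e, he, rfl⟩ := List.mem_map.1 hΦ
    have hel := (mem_tuples.1 he).1
    refine WFO.fv_sumVars ?_
    simp only [WFO.fv, Set.union_subset_iff]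
    refine ⟨⟨hel ▸ fv_runFormula_subset b l p q e, ?_⟩, by simp⟩
    rintro i ⟨h1, h2⟩
    have h3 : i < e.length + 1 := fv_weightFormula_subset b l p q e _ h1
    have h4 : i ≠ l.length := h2
    exact show i < l.length by omega

/-! Semantics. -/

/-- `exists_match_of_WEF` is used both ways: a disjunct carries a run on a short word over to `u`,
and a run on `u` is carried to a short word, where the search finds it. -/
theorem sat_runFormula [Fintype α] {l : List (Edge α R)} (hl : EdgesAperiodic l) {p q : ℕ}
    {e : List (Edge α R)} (he : e.length ≤ l.length + 1) {u : List α} (hu : u ≠ [])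
    (σ : ℕ → Fin u.length) :
    FO.Sat u σ (runFormula (Fintype.card α) l p q e) ↔ ∃ ρ, Run l p q u ρ ∧
      Match (height (shortBound (Fintype.card α) l) l) l.length ρ (FO.vals σ e.length) e := by
  classical
  have hval : ∀ y ∈ FO.vals σ e.length, y < u.length := by
    intro y hy
    obtain ⟨i, _, rfl⟩ := List.mem_map.1 hy
    exact (σ i).2
  rw [runFormula, FO.sat_disj]
  constructor
  · rintro ⟨φ, hφ, hsat⟩
    obtain ⟨x, hx, rfl⟩ := List.mem_map.1 hφ
    obtain ⟨hx1, hx2⟩ := List.mem_filter.1 hx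
    obtain ⟨ρ, hρ, hx3⟩ := List.mem_flatMap.1 hx1
    obtain ⟨t, ht, rfl⟩ := List.mem_map.1 hx3
    obtain ⟨h1, h2, h3⟩ : Witness _ l p q e (ρ, t) := by simpa using hx2
    obtain ⟨ht1, ht2⟩ := mem_tuples.1 ht
    have ht3 : ∀ x ∈ t, x < (ρ.map fun δ => δ.2.1).length := by simpa using ht2
    rw [FO.sat_hintikka ht3, ht1] at hsat
    exact exists_match_of_WEF hl (by simpa using h1) (by simp [ht1]) ht1.symm hval hsat
      ⟨(mem_seqs.1 hρ).2, pathEnd_eq_some.1 h2, rfl⟩ h3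
  · rintro ⟨ρ, hρ, hm⟩
    obtain ⟨v, t, hv, ht1, ht2, hEF⟩ := exists_short_points l u hval (by simpa using he)
    rw [FO.length_vals] at ht1
    obtain ⟨ρ', hρ', hm'⟩ := exists_match_of_WEF hl hu (by simp [ht1]) (by simp) ht2 hEF hρ hm
    have hv0 : v ≠ [] := hEF.one_nonempty (by simp [runRank]) hu
    have hlen := hρ'.length_eq
    refine ⟨_, List.mem_map.2 ⟨(ρ', t), List.mem_filter.2 ⟨List.mem_flatMap.2
      ⟨ρ', mem_seqs.2 ⟨hlen ▸ hv, hρ'.1⟩, List.mem_map.2 ⟨t, mem_tuples.2 ⟨ht1, ?_⟩, rfl⟩⟩, ?_⟩,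
      rfl⟩, ?_⟩
    · simpa [hlen] using ht2
    · simp only [decide_eq_true_eq]
      refine ⟨?_, pathEnd_eq_some.2 hρ'.2.1, hm'⟩
      rintro (rfl : ρ' = [])
      exact hv0 (List.eq_nil_of_length_eq_zero hlen.symm)
    · dsimp only
      rw [hρ'.2.2, FO.sat_hintikka ht2, ht1, ← swap_preimage_zipSet]
      exact hEF.symm

/-- Only `ρ` matches `e`, so the test for `δ` succeeds exactly when `δ` is the transition of `ρ` at
`i`. Since that transition is in `l`, the default `r` is never used. -/
theorem sem_weightFormula [Fintype α] {l : List (Edge α R)} (hl : EdgesAperiodic l)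
    (hun : EdgesUnambiguous l) {p q : ℕ} {e : List (Edge α R)} (he : e.length = l.length) (r : R)
    {u : List α} (hu : u ≠ []) (σ : ℕ → Fin u.length) (i : Fin u.length) {ρ : List (Edge α R)}
    (hρ : Run l p q u ρ)
    (hm : Match (height (shortBound (Fintype.card α) l) l) l.length ρ (FO.vals σ e.length) e) :
    (weightFormula (Fintype.card α) l p q e r).sem u (Function.update σ e.length i) =
      (ρ[i.1]'(by rw [hρ.length_eq]; exact i.2)).2.2.2 := by
  have hi : i.1 < ρ.length := by rw [hρ.length_eq]; exact i.2
  have hsat : ∀ δ, FO.Sat u (Function.update σ e.length i)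
      (runFormula (Fintype.card α) l p q (e ++ [δ])) ↔ ρ[i.1] = δ := by
    intro δ
    rw [sat_runFormula hl (by simp [he]) hu, List.length_append, List.length_singleton,
      FO.vals_update]
    -- The additional entry has index `l.length`, just beyond the canonical indices, so nothing but
    -- the transition at its position is prescribed.
    have key : ∀ ρ', Match (height (shortBound (Fintype.card α) l) l) l.length ρ'
        (FO.vals σ e.length ++ [i.1]) (e ++ [δ]) ↔
        Match (height (shortBound (Fintype.card α) l) l) l.length ρ' (FO.vals σ e.length) e ∧
          ρ'[i.1]? = some δ := by
      intro ρ'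
      have hd : ∀ j < e.length, (FO.vals σ e.length ++ [i.1]).getD j 0 =
          (FO.vals σ e.length).getD j 0 := fun j hj => List.getD_append _ _ _ _ (by simpa using hj)
      have hd' : (FO.vals σ e.length ++ [i.1]).getD e.length 0 = i.1 := by
        rw [List.getD_append_right _ _ _ _ (by simp)]; simp
      constructor
      · rintro ⟨h1, h2⟩
        refine ⟨⟨fun j hj => ?_, fun j hj δ' hδ' hj' => ?_⟩, ?_⟩
        · rw [← hd j hj, h1 j (by simp; omega), List.getElem?_append_left hj]
        · rw [← hd j (by omega)]
          exact h2 j hj δ' (by simp [hδ']) (by rw [List.getElem?_append_left (by omega), hj'])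
        · have := h1 e.length (by simp)
          rw [hd'] at this
          simpa using this
      · rintro ⟨⟨h1, h2⟩, h3⟩
        refine ⟨fun j hj => ?_, fun j hj δ' hδ' hj' => ?_⟩
        · rw [List.length_append, List.length_singleton] at hj
          rcases Nat.lt_succ_iff_lt_or_eq.1 hj with hj | rfl
          · rw [hd j hj, h1 j hj, List.getElem?_append_left hj]
          · rw [hd', h3]; simp
        · rw [List.getElem?_append_left (by omega)] at hj'
          rw [hd j (by omega)]
          exact h2 j hj δ' (List.mem_of_getElem? hj') hj'
    simp only [key]
    constructor
    · rintro ⟨ρ', h1, h2, h3⟩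
      obtain rfl := (isHeight_height hl).match_unique hun hρ h1 he.ge hm h2
      rw [List.getElem?_eq_getElem hi] at h3
      exact Option.some.inj h3
    · rintro rfl
      exact ⟨ρ, hρ, hm, List.getElem?_eq_getElem hi⟩
  have key : ∀ L : List (Edge α R), ρ[i.1] ∈ L →
      (L.foldr (fun δ Ψ => StepFO.ite (runFormula (Fintype.card α) l p q (e ++ [δ]))
      (StepFO.const δ.2.2.2) Ψ) (StepFO.const r)).sem u (Function.update σ e.length i) =
      ρ[i.1].2.2.2 := by
    intro L
    induction L with
    | nil => simp
    | cons δ L ih =>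
      intro hL
      rw [List.foldr_cons, StepFO.sem]
      split_ifs with hδ
      · rw [StepFO.sem, (hsat δ).1 hδ]
      · exact ih ((List.mem_cons.1 hL).resolve_left (mt (hsat δ).2 hδ))
  exact key l (hρ.1 _ (List.getElem_mem _))

theorem WFO.sem_sumList (u : List α) (σ : ℕ → Fin u.length) (L : List (WFO α R)) :
    (sumList L).sem u σ = (L.map fun Φ => Φ.sem u σ).sum := by
  induction L with
  | nil => rfl
  | cons Φ L ih => simp [sumList, WFO.sem, ih]

/-- The valuation `σ`, changed to `t` on the first variables. -/
def updVals {n : ℕ} (σ : ℕ → Fin n) (t : List (Fin n)) (i : ℕ) : Fin n := t[i]?.getD (σ i)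

theorem updVals_concat {n : ℕ} (σ : ℕ → Fin n) (t : List (Fin n)) (x : Fin n) :
    Function.update (updVals σ t) t.length x = updVals σ (t ++ [x]) := by
  funext i
  rcases lt_trichotomy i t.length with h | rfl | h
  · rw [Function.update_of_ne h.ne, updVals, updVals, List.getElem?_append_left h]
  · simp [updVals]
  · rw [Function.update_of_ne h.ne', updVals, updVals, List.getElem?_eq_none (by omega),
      List.getElem?_eq_none (by simp; omega)]

theorem vals_updVals {u : List α} (σ : ℕ → Fin u.length) (t : List (Fin u.length)) :
    FO.vals (updVals σ t) t.length = t.map Fin.val := by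
  refine List.ext_getElem (by simp) fun i h1 h2 => ?_
  have : i < t.length := by simpa using h2
  simp [FO.vals, updVals, this]

theorem WFO.sem_sumVars (u : List α) (σ : ℕ → Fin u.length) (j : ℕ) (Φ : WFO α R) :
    (sumVars j Φ).sem u σ =
      ∑ t ∈ (tuples (List.finRange u.length) j).toFinset, Φ.sem u (updVals σ t) := by
  induction j generalizing Φ with
  | zero =>
    have : updVals σ [] = σ := funext fun i => by simp [updVals]
    simp [sumVars, tuples, this]
  | succ j ih =>
    have hnd := fun j => nodup_tuples (List.nodup_finRange u.length) j
    rw [sumVars, ih, List.sum_toFinset _ (hnd j), List.sum_toFinset _ (hnd (j + 1)), tuples,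
      List.map_flatMap, List.flatMap_def, List.sum_flatten, List.map_map]
    congr 1
    refine List.map_congr_left fun t ht => ?_
    simp only [WFO.sem, Function.comp_apply, List.map_map, Finset.sum_eq_multiset_sum]
    rw [← (mem_tuples.1 ht).1]
    simp only [updVals_concat]
    rw [← Finset.sum_eq_multiset_sum, ← List.sum_ofFn, List.ofFn_eq_map]
    rfl

/-- By `match_unique` the inner sum has at most one nonzero term. Writing the if-then-else as a sum
over all runs prepares the interchange of sums in `sem_pairFormula`. -/
theorem sem_matchFormula [Fintype α] {l : List (Edge α R)} (hl : EdgesAperiodic l)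
    (hun : EdgesUnambiguous l) {p q : ℕ} {e : List (Edge α R)} (he : e.length = l.length) (r : R)
    {u : List α} (hu : u ≠ []) (σ : ℕ → Fin u.length) (S : Finset (List (Edge α R)))
    (hS : ∀ ρ, ρ ∈ S ↔ Run l p q u ρ) [∀ ρ t, Decidable
      (Match (height (shortBound (Fintype.card α) l) l) l.length ρ t e)] :
    (matchFormula (Fintype.card α) l p q e r).sem u σ =
      ∑ t ∈ (tuples (List.finRange u.length) l.length).toFinset, ∑ ρ ∈ S,
        if Match (height (shortBound (Fintype.card α) l) l) l.length ρ (t.map Fin.val) e then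
          {ρ.map fun δ => δ.2.2.2} else 0 := by
  rw [matchFormula, WFO.sem_sumVars]
  refine Finset.sum_congr rfl fun t ht => ?_
  have htl : t.length = l.length := (mem_tuples.1 (List.mem_toFinset.1 ht)).1
  have hv : FO.vals (updVals σ t) e.length = t.map Fin.val := by
    rw [he, ← htl, vals_updVals]
  rw [WFO.sem, sat_runFormula hl (by omega) hu, hv]
  split_ifs with hex
  · obtain ⟨ρ, hρ, hm⟩ := hex
    rw [Finset.sum_eq_single_of_mem ρ ((hS ρ).2 hρ), if_pos hm, WFO.sem]
    · congr 1
      refine List.ext_getElem (by simp [hρ.length_eq]) fun i h1 h2 => ?_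
      rw [List.getElem_ofFn, List.getElem_map]
      have h3 := sem_weightFormula hl hun he r hu (updVals σ t) ⟨i, by simpa using h1⟩ hρ
        (by rwa [hv])
      simpa only [he] using h3
    · intro ρ' hρ' hne
      rw [if_neg]
      exact fun hm' => hne ((isHeight_height hl).match_unique hun ((hS _).1 hρ') hρ he.ge hm' hm)
  · rw [WFO.sem, Finset.sum_eq_zero]
    intro ρ hρ
    rw [if_neg fun hm => hex ⟨ρ, (hS ρ).1 hρ, hm⟩]

/-- Interchanging the sums leaves, for each run, the number of pairs `(t, e)` that it matches, which
is one. `l.Nodup` ensures that each `e` is enumerated only once. -/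
theorem sem_pairFormula [Fintype α] {l : List (Edge α R)} (hl : EdgesAperiodic l)
    (hun : EdgesUnambiguous l) (hnd : l.Nodup) {p q : ℕ} {u : List α} (hu : u ≠ [])
    (σ : ℕ → Fin u.length) (S : Finset (List (Edge α R))) (hS : ∀ ρ, ρ ∈ S ↔ Run l p q u ρ) :
    (pairFormula (Fintype.card α) l p q).sem u σ = S.val.map fun ρ => ρ.map fun δ => δ.2.2.2 := by
  classical
  -- An empty list admits no run on a nonempty word. Otherwise its head supplies the default weight,
  -- as `R` has no distinguished element.
  rcases hl0 : l.head? with _ | d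
  · have hl0 : l = [] := List.head?_eq_none_iff.1 hl0
    have hS0 : S = ∅ := by
      refine Finset.eq_empty_of_forall_notMem fun ρ hρ => ?_
      have := ((hS ρ).1 hρ).source_mem hu
      simp [hl0, states] at this
    simp [pairFormula, hl0, hS0, WFO.sem]
  · simp only [pairFormula, hl0, Option.elim_some]
    rw [WFO.sem_sumList, List.map_map, ← List.sum_toFinset _ (nodup_tuples hnd _)]
    calc _ = ∑ e ∈ (tuples l l.length).toFinset,
          ∑ t ∈ (tuples (List.finRange u.length) l.length).toFinset, ∑ ρ ∈ S,
          if Match (height (shortBound (Fintype.card α) l) l) l.length ρ (t.map Fin.val) e then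
            {ρ.map fun δ => δ.2.2.2} else 0 :=
          Finset.sum_congr rfl fun e he => sem_matchFormula hl hun
            (mem_tuples.1 (List.mem_toFinset.1 he)).1 _ hu σ S hS
      _ = ∑ ρ ∈ S, ∑ e ∈ (tuples l l.length).toFinset,
          ∑ t ∈ (tuples (List.finRange u.length) l.length).toFinset,
          if Match (height (shortBound (Fintype.card α) l) l) l.length ρ (t.map Fin.val) e then
            {ρ.map fun δ => δ.2.2.2} else 0 :=
          (Finset.sum_congr rfl fun e _ => Finset.sum_comm).trans Finset.sum_comm
      _ = ∑ ρ ∈ S, {ρ.map fun δ => δ.2.2.2} := by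
          refine Finset.sum_congr rfl fun ρ hρ => ?_
          have hρ := (hS ρ).1 hρ
          obtain ⟨t, ht, e, he, hm⟩ := hρ.exists_match hu
            (height (shortBound (Fintype.card α) l) l)
          obtain ⟨ht1, ht2⟩ := mem_tuples.1 ht
          have he1 := (mem_tuples.1 he).1
          lift t to List (Fin u.length) using fun x hx => List.mem_range.1 (ht2 x hx)
          have huniq : ∀ e' ∈ (tuples l l.length).toFinset,
              ∀ t' ∈ (tuples (List.finRange u.length) l.length).toFinset,
              Match (height (shortBound (Fintype.card α) l) l) l.length ρ (t'.map Fin.val) e' →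
              t' = t ∧ e' = e := by
            intro e' he' t' ht' hm'
            obtain ⟨h1, h2⟩ := (isHeight_height hl).match_positions_unique hρ
              (by simpa using (mem_tuples.1 (List.mem_toFinset.1 ht')).1) ht1
              (mem_tuples.1 (List.mem_toFinset.1 he')).1 he1 hm' hm
            exact ⟨List.map_injective_iff.2 Fin.val_injective h1, h2⟩
          have htm : t ∈ (tuples (List.finRange u.length) l.length).toFinset :=
            List.mem_toFinset.2 (mem_tuples.2 ⟨by simpa using ht1, by simp⟩)
          rw [Finset.sum_eq_single_of_mem e (List.mem_toFinset.2 he),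
            Finset.sum_eq_single_of_mem t htm, if_pos hm]
          · intro t' ht' hne
            exact if_neg fun hm' => hne (huniq e (List.mem_toFinset.2 he) t' ht' hm').1
          · intro e' he' hne
            exact Finset.sum_eq_zero fun t' ht' =>
              if_neg fun hm' => hne (huniq e' he' t' ht' hm').2
      _ = _ := by
          rw [Finset.sum_eq_multiset_sum,
            ← Multiset.sum_map_singleton (S.val.map fun ρ => ρ.map fun δ => δ.2.2.2),
            Multiset.map_map]
          rfl

end Formulas

/-! ### From automata to lists of transitions -/

section Listing

variable {α R Q : Type*} {A : WAut α R Q} {ι : Q → ℕ} {l : List (Edge α R)}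

/-- `l` lists the transitions of `A`, whose states are numbered by `ι`. -/
def Listing (A : WAut α R Q) (ι : Q → ℕ) (l : List (Edge α R)) : Prop :=
  ∀ (x : ℕ) (a : α) (y : ℕ) (r : R), (x, a, y, r) ∈ l ↔
    ∃ (p q : Q) (h : (p, a, q) ∈ A.trans), ι p = x ∧ ι q = y ∧ A.wgt ⟨(p, a, q), h⟩ = r

/-- The transition of the list for a transition of the automaton. -/
def edgeOf (A : WAut α R Q) (ι : Q → ℕ) (δ : A.Tr) : Edge α R :=
  (ι δ.1.1, δ.1.2.1, ι δ.1.2.2, A.wgt δ)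

theorem edgeOf_injective (hι : Function.Injective ι) : Function.Injective (edgeOf A ι) := by
  rintro ⟨⟨p, a, q⟩, h⟩ ⟨⟨p', a', q'⟩, h'⟩ heq
  simp only [edgeOf, Prod.mk.injEq] at heq
  obtain ⟨h1, h2, h3, -⟩ := heq
  obtain rfl := hι h1
  obtain rfl := hι h3
  subst h2
  rfl

theorem Listing.mem_iff (hL : Listing A ι l) {e : Edge α R} : e ∈ l ↔ ∃ δ, edgeOf A ι δ = e := by
  obtain ⟨x, a, y, r⟩ := e
  rw [hL]
  constructor
  · rintro ⟨p, q, h, rfl, rfl, rfl⟩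
    exact ⟨⟨(p, a, q), h⟩, rfl⟩
  · rintro ⟨⟨⟨p, a', q⟩, h⟩, heq⟩
    simp only [edgeOf, Prod.mk.injEq] at heq
    obtain ⟨rfl, rfl, rfl, rfl⟩ := heq
    exact ⟨p, q, h, rfl, rfl, rfl⟩

theorem path_map_edgeOf (hι : Function.Injective ι) {p q : Q} {ρ : List A.Tr} :
    Path (ι p) (ι q) (ρ.map (edgeOf A ι)) ↔ A.IsRun p q ρ := by
  induction ρ generalizing p with
  | nil => exact hι.eq_iff
  | cons δ ρ ih =>
    simp only [List.map_cons, Path, WAut.IsRun]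
    exact and_congr hι.eq_iff ih

theorem Listing.run_iff (hι : Function.Injective ι) (hL : Listing A ι l) {p q : Q} {u : List α}
    {ρ : List (Edge α R)} :
    Run l (ι p) (ι q) u ρ ↔ ∃ ρ' ∈ A.runs p q u, ρ'.map (edgeOf A ι) = ρ := by
  constructor
  · rintro ⟨h1, h2, h3⟩
    obtain ⟨ρ', rfl⟩ : ρ ∈ Set.range (List.map (edgeOf A ι)) := by
      rw [Set.range_list_map]
      exact fun δ hδ => hL.mem_iff.1 (h1 δ hδ)
    exact ⟨ρ', ⟨(path_map_edgeOf hι).1 h2, by rw [← h3, List.map_map]; rfl⟩, rfl⟩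
  · rintro ⟨ρ', ⟨h1, h2⟩, rfl⟩
    refine ⟨fun δ hδ => ?_, (path_map_edgeOf hι).2 h1, by rw [← h2, List.map_map]; rfl⟩
    obtain ⟨δ', -, rfl⟩ := List.mem_map.1 hδ
    exact hL.mem_iff.2 ⟨δ', rfl⟩

theorem Listing.exists_of_mem_states (hL : Listing A ι l) {x : ℕ} (hx : x ∈ states l) :
    ∃ p, ι p = x := by
  rcases List.mem_append.1 hx with h | h <;> obtain ⟨e, he, rfl⟩ := List.mem_map.1 h <;>
    obtain ⟨δ, rfl⟩ := hL.mem_iff.1 he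
  exacts [⟨_, rfl⟩, ⟨_, rfl⟩]

theorem Listing.edgesAperiodic (hι : Function.Injective ι) (hL : Listing A ι l)
    (hA : A.Aperiodic) : EdgesAperiodic l := by
  obtain ⟨m, hm, h⟩ := hA
  refine ⟨m, fun x y u hu => ?_⟩
  have hne : ∀ j, 1 ≤ j → (List.replicate j u).flatten ≠ [] := by
    intro j hj h0
    rw [List.flatten_eq_nil_iff] at h0
    exact hu (h0 u (List.mem_replicate.2 ⟨by omega, rfl⟩))
  by_cases hxy : x ∈ states l ∧ y ∈ states l
  · obtain ⟨p, rfl⟩ := hL.exists_of_mem_states hxy.1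
    obtain ⟨q, rfl⟩ := hL.exists_of_mem_states hxy.2
    have key : ∀ w, (∃ ρ, Run l (ι p) (ι q) w ρ) ↔ w ∈ A.lang p q := by
      intro w
      simp only [hL.run_iff hι]
      exact ⟨fun ⟨_, ρ, h, _⟩ => ⟨ρ, h⟩, fun ⟨ρ, h⟩ => ⟨_, ρ, h, rfl⟩⟩
    rw [key, key]
    exact h p q u hu
  -- No run on a nonempty word starts or ends at a number that does not occur in `l`. Here `1 ≤ m`
  -- is needed for `u ^ m` to be nonempty.
  · constructor <;> rintro ⟨ρ, hρ⟩
    · exact absurd ⟨hρ.source_mem (hne _ hm), hρ.target_mem (hne _ hm)⟩ hxy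
    · exact absurd ⟨hρ.source_mem (hne _ (by omega)), hρ.target_mem (hne _ (by omega))⟩ hxy

theorem Listing.edgesUnambiguous (hι : Function.Injective ι) (hL : Listing A ι l)
    (hA : A.SCCUnambiguous) : EdgesUnambiguous l := by
  rintro x y ⟨v, ρ₁, h1⟩ ⟨w, ρ₂, h2⟩ u ρ ρ' hρ hρ'
  by_cases hu : u = []
  · subst hu
    rw [List.eq_nil_of_length_eq_zero hρ.length_eq, List.eq_nil_of_length_eq_zero hρ'.length_eq]
  · obtain ⟨p, rfl⟩ := hL.exists_of_mem_states (hρ.source_mem hu)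
    obtain ⟨q, rfl⟩ := hL.exists_of_mem_states (hρ.target_mem hu)
    obtain ⟨σ₁, h3, -⟩ := (hL.run_iff hι).1 h1
    obtain ⟨σ₂, h4, -⟩ := (hL.run_iff hι).1 h2
    obtain ⟨σ, h5, rfl⟩ := (hL.run_iff hι).1 hρ
    obtain ⟨σ', h6, rfl⟩ := (hL.run_iff hι).1 hρ'
    rw [hA p q (Or.inr ⟨⟨σ₁, h3.1⟩, σ₂, h4.1⟩) u hu h5 h6]

open Classical in
/-- The sentence for a pair of states. -/
noncomputable def pairSentence (b : ℕ) (l : List (Edge α R)) (p q : ℕ) : WFO α R :=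
  pairFormula b l.dedup p q

open Classical in
/-- The sentence for lists of initial and final states. -/
noncomputable def accSentence (b : ℕ) (l : List (Edge α R)) (lI lF : List ℕ) : WFO α R :=
  WFO.sumList (lI.dedup.flatMap fun p => lF.dedup.map fun q => pairSentence b l p q)

theorem isSentence_pairSentence (b : ℕ) (l : List (Edge α R)) (p q : ℕ) :
    (pairSentence b l p q).IsSentence := isSentence_pairFormula _ _ _ _

theorem isSentence_accSentence (b : ℕ) (l : List (Edge α R)) (lI lF : List ℕ) :
    (accSentence b l lI lF).IsSentence := by
  refine WFO.fv_sumList fun Φ hΦ => ?_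
  obtain ⟨p, -, h⟩ := List.mem_flatMap.1 hΦ
  obtain ⟨q, -, rfl⟩ := List.mem_map.1 h
  exact isSentence_pairSentence b l p q

theorem Listing.usem_eq [Fintype α] (hι : Function.Injective ι) (hL : Listing A ι l)
    (hA : A.Aperiodic) (hU : A.SCCUnambiguous) (p q : Q) :
    A.usem p q = (pairSentence (Fintype.card α) l (ι p) (ι q)).usem := by
  classical
  funext u
  have hL' : Listing A ι l.dedup := fun x a y r => by rw [List.mem_dedup]; exact hL x a y r
  have hmap : Function.Injective (List.map (edgeOf A ι)) :=
    List.map_injective_iff.2 (edgeOf_injective hι)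
  have := sem_pairFormula (hL'.edgesAperiodic hι hA) (hL'.edgesUnambiguous hι hU)
    (List.nodup_dedup l) (p := ι p) (q := ι q) u.2
    (fun _ => ⟨0, List.length_pos_of_ne_nil u.2⟩)
    ((A.runs_finite p q u.1).toFinset.map ⟨_, hmap⟩) (by
      intro ρ
      simp [hL'.run_iff hι])
  rw [WFO.usem, pairSentence]
  refine Eq.trans ?_ (Eq.trans this.symm ?_)
  · rw [Finset.map_val, Multiset.map_map]
    refine Multiset.map_congr rfl fun ρ _ => ?_
    simp [WAut.wgtSeq, edgeOf, Function.comp_def]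
  · congr!

theorem Listing.usemAcc_eq [Fintype α] [DecidableEq Q] (hι : Function.Injective ι)
    (hL : Listing A ι l) (hA : A.Aperiodic) (hU : A.SCCUnambiguous) (lI lF : List Q) :
    A.usemAcc lI.toFinset lF.toFinset =
      (accSentence (Fintype.card α) l (lI.map ι) (lF.map ι)).usem := by
  funext u
  have hsum : ∀ (L : List Q) (f : Q → Multiset (List R)),
      ∑ p ∈ L.toFinset, f p = (L.dedup.map f).sum := by
    intro L f
    rw [← List.sum_toFinset _ (List.nodup_dedup L)]
    exact Finset.sum_congr (by ext; simp) fun _ _ => rfl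
  rw [WFO.usem, accSentence, WFO.sem_sumList, WAut.usemAcc, hsum,
    List.dedup_map_of_injective hι, List.dedup_map_of_injective hι,
    List.map_flatMap, List.flatMap_def, List.sum_flatten, List.map_map, List.map_map]
  congr 1
  refine List.map_congr_left fun p _ => ?_
  rw [hsum, Function.comp_apply, Function.comp_apply, List.map_map, List.map_map]
  congr 1
  refine List.map_congr_left fun q _ => ?_
  rw [hL.usem_eq hι hA hU]
  rfl

end Listing

/-! ### Primitive recursiveness -/

section Helpers

variable {γ β : Type*} [Primcodable γ] [Primcodable β]

theorem primrecPred_forall_mem {L : γ → List β} {r : γ → β → Prop} (hL : Primrec L)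
    (hr : PrimrecRel r) : PrimrecPred fun c => ∀ x ∈ L c, r c x :=
  PrimrecRel.comp (PrimrecRel.forall_mem_list hr.swap) hL Primrec.id

theorem primrecPred_exists_mem {L : γ → List β} {r : γ → β → Prop} (hL : Primrec L)
    (hr : PrimrecRel r) : PrimrecPred fun c => ∃ x ∈ L c, r c x :=
  PrimrecRel.comp (PrimrecRel.exists_mem_list hr.swap) hL Primrec.id

theorem primrecPred_forall_lt {n : γ → ℕ} {r : γ → ℕ → Prop} (hn : Primrec n)
    (hr : PrimrecRel r) : PrimrecPred fun c => ∀ x < n c, r c x :=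
  (primrecPred_forall_mem (Primrec.list_range.comp hn) hr).of_eq fun c => by simp

theorem PrimrecPred.imp {p q : γ → Prop} (hp : PrimrecPred p) (hq : PrimrecPred q) :
    PrimrecPred fun c => p c → q c :=
  (hp.not.or hq).of_eq fun c => by tauto

theorem primrec_filter {L : γ → List β} {r : γ → β → Prop} [∀ c, DecidablePred (r c)]
    (hL : Primrec L) (hr : PrimrecRel r) : Primrec fun c => (L c).filter fun x => r c x := by
  classical
  exact ((PrimrecRel.listFilter (R := fun a b => r b a) hr.swap).comp hL Primrec.id).of_eq
    fun c => List.filter_congr (by simp)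

theorem primrec_pow : Primrec₂ ((· ^ ·) : ℕ → ℕ → ℕ) := Primrec₂.unpaired'.1 Nat.Primrec.pow

/-- `List.dedup` keeps last occurrences, so it is a right fold. -/
theorem primrec_dedup [DecidableEq β] : Primrec (List.dedup : List β → List β) := by
  have h : ∀ L : List β, L.foldr (fun x M => if x ∈ M then M else x :: M) [] = L.dedup := by
    intro L
    induction L with
    | nil => rfl
    | cons x L ih =>
      rw [List.foldr_cons, ih]
      split_ifs with hx
      · rw [List.dedup_cons_of_mem (List.mem_dedup.1 hx)]
      · rw [List.dedup_cons_of_notMem (mt List.mem_dedup.2 hx)]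
  have hmem : PrimrecPred fun z : List β × β × List β => z.2.1 ∈ z.2.2 :=
    (primrecPred_exists_mem (L := fun z : List β × β × List β => z.2.2)
      (r := fun z x => x = z.2.1) (Primrec.snd.comp Primrec.snd)
      (Primrec.eq.comp Primrec.snd (Primrec.fst.comp (Primrec.snd.comp Primrec.fst)))).of_eq
      fun z => by simp
  exact (Primrec.list_foldr (f := fun L : List β => L) (g := fun _ => [])
    (h := fun _ z => if z.1 ∈ z.2 then z.2 else z.1 :: z.2) Primrec.id (Primrec.const [])
    (Primrec.ite hmem (Primrec.snd.comp Primrec.snd) (Primrec.list_cons.comp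
      (Primrec.fst.comp Primrec.snd) (Primrec.snd.comp Primrec.snd)))).of_eq h

theorem primrec_tuples : Primrec₂ (tuples : List β → ℕ → List (List β)) := by
  have hstep : Primrec₂ fun (L : List β) (z : ℕ × List (List β)) =>
      z.2.flatMap fun t => L.map fun x => t ++ [x] := by
    refine Primrec.list_flatMap (Primrec.snd.comp Primrec.snd) ?_
    refine Primrec.list_map (Primrec.fst.comp Primrec.fst) ?_
    exact Primrec.list_concat.comp (Primrec.snd.comp Primrec.fst) Primrec.snd
  refine (Primrec.nat_rec (Primrec.const [[]]) hstep).of_eq ?_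
  intro L m
  induction m with
  | zero => rfl
  | succ m ih => simp only [tuples] at ih ⊢; rw [ih]

theorem primrec_seqs : Primrec₂ (seqs : List β → ℕ → List (List β)) :=
  Primrec.list_flatMap (Primrec.list_range.comp Primrec.snd)
    (primrec_tuples.comp (Primrec.fst.comp Primrec.fst) Primrec.snd)

theorem primrec_cfRank : Primrec cfRank := by
  have hstep : Primrec₂ fun (n K : ℕ) => (n + 1) ^ (n + 1) * (K + 1) :=
    Primrec.nat_mul.comp (primrec_pow.comp (Primrec.succ.comp Primrec.fst)
      (Primrec.succ.comp Primrec.fst)) (Primrec.succ.comp Primrec.snd)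
  refine (Primrec.nat_rec₁ 0 hstep).of_eq fun n => ?_
  induction n with
  | zero => rfl
  | succ n ih => simp only [cfRank, ih]

theorem primrec_tyBound (b : ℕ) : Primrec₂ (tyBound b) := by
  have h0 : Primrec fun D : ℕ => (2 ^ D) ^ D * (b + 1) ^ D :=
    Primrec.nat_mul.comp
      (primrec_pow.comp (primrec_pow.comp (Primrec.const 2) Primrec.id) Primrec.id)
      (primrec_pow.comp (Primrec.const (b + 1)) Primrec.id)
  have hstep : Primrec₂ fun (D : ℕ) (z : ℕ × ℕ) => (2 ^ D) ^ D * (b + 1) ^ D * 2 ^ z.2 :=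
    Primrec.nat_mul.comp (h0.comp Primrec.fst)
      (primrec_pow.comp (Primrec.const 2) (Primrec.snd.comp Primrec.snd))
  refine (Primrec.nat_rec h0 hstep).of_eq ?_
  intro D k
  induction k with
  | zero => rfl
  | succ k ih => simp only [tyBound] at ih ⊢; rw [ih]

end Helpers

/-! ### Primitive recursiveness of heights and of matching -/

section Runs

variable {α R : Type*} [Primcodable α] [Primcodable R]

theorem primrec_src : Primrec fun δ : Edge α R => δ.1 := Primrec.fst

theorem primrec_lab : Primrec fun δ : Edge α R => δ.2.1 := Primrec.fst.comp Primrec.snd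

theorem primrec_tgt : Primrec fun δ : Edge α R => δ.2.2.1 :=
  Primrec.fst.comp (Primrec.snd.comp Primrec.snd)

theorem primrec_wt : Primrec fun δ : Edge α R => δ.2.2.2 :=
  Primrec.snd.comp (Primrec.snd.comp Primrec.snd)

theorem primrec_runRank : Primrec (runRank : List (Edge α R) → ℕ) :=
  Primrec.succ.comp (primrec_cfRank.comp (primrec_pow.comp (Primrec.const 2)
    (Primrec.nat_mul.comp (Primrec.const 2) Primrec.list_length)))

theorem primrec_shortBound (b : ℕ) : Primrec (shortBound b : List (Edge α R) → ℕ) := by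
  have h : Primrec fun l : List (Edge α R) => runRank l + (l.length + 1) :=
    Primrec.nat_add.comp primrec_runRank (Primrec.succ.comp Primrec.list_length)
  exact (primrec_tyBound b).comp h h

theorem primrec_pathEnd : Primrec₂ (pathEnd : ℕ → List (Edge α R) → Option ℕ) := by
  have hstep : Primrec₂ fun (_ : ℕ × List (Edge α R)) (z : Option ℕ × Edge α R) =>
      stepState z.1 z.2 :=
    Primrec.ite (Primrec.eq.comp (Primrec.fst.comp Primrec.snd)
        (Primrec.option_some.comp (primrec_src.comp (Primrec.snd.comp Primrec.snd))))
      (Primrec.option_some.comp (primrec_tgt.comp (Primrec.snd.comp Primrec.snd)))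
      (Primrec.const none)
  exact Primrec.list_foldl Primrec.snd (Primrec.option_some.comp Primrec.fst) hstep

theorem primrecPred_reach : PrimrecPred fun z : ℕ × List (Edge α R) × ℕ × ℕ =>
    Reach z.1 z.2.1 z.2.2.1 z.2.2.2 := by
  have hxy : Primrec fun z : ℕ × List (Edge α R) × ℕ × ℕ => z.2.2 :=
    Primrec.snd.comp Primrec.snd
  refine primrecPred_exists_mem
    (primrec_seqs.comp (Primrec.fst.comp Primrec.snd) Primrec.fst) ?_
  exact Primrec.eq.comp
    (primrec_pathEnd.comp (Primrec.fst.comp (hxy.comp Primrec.fst)) Primrec.snd)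
    (Primrec.option_some.comp (Primrec.snd.comp (hxy.comp Primrec.fst)))

theorem primrec_height : Primrec fun z : ℕ × List (Edge α R) × ℕ => height z.1 z.2.1 z.2.2 := by
  classical
  have hr : PrimrecRel fun (z : ℕ × List (Edge α R) × ℕ) (δ : Edge α R) =>
      ¬ Reach z.1 z.2.1 z.2.2 δ.1 := by
    refine PrimrecPred.not ?_
    refine primrecPred_reach.comp (f := fun w : (ℕ × List (Edge α R) × ℕ) × Edge α R =>
      (w.1.1, w.1.2.1, w.1.2.2, w.2.1)) ?_
    exact (Primrec.fst.comp Primrec.fst).pair ((Primrec.fst.comp (Primrec.snd.comp Primrec.fst)).pair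
      ((Primrec.snd.comp (Primrec.snd.comp Primrec.fst)).pair (primrec_src.comp Primrec.snd)))
  exact (Primrec.list_length.comp (primrec_filter (Primrec.fst.comp Primrec.snd) hr)).of_eq
    fun z => by unfold height; congr!

theorem primrecPred_canon (b : ℕ) {γ : Type*} [Primcodable γ] {l : γ → List (Edge α R)}
    {n i x : γ → ℕ} {δ : γ → Edge α R} (hl : Primrec l) (hn : Primrec n) (hi : Primrec i)
    (hx : Primrec x) (hδ : Primrec δ) :
    PrimrecPred fun z => Canon (height (shortBound b (l z)) (l z)) (n z) (i z) (x z) (δ z) := by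
  have hh : ∀ {f : γ → ℕ}, Primrec f → Primrec fun z => height (shortBound b (l z)) (l z) (f z) :=
    fun hf => primrec_height.comp (((primrec_shortBound b).comp hl).pair (hl.pair hf))
  have h1 : PrimrecPred fun z => i z < height (shortBound b (l z)) (l z) (δ z).2.2.1 :=
    Primrec.nat_lt.comp hi (hh (primrec_tgt.comp hδ))
  have h2 : PrimrecPred fun z => x z + 1 = n z := Primrec.eq.comp (Primrec.succ.comp hx) hn
  have h3 : PrimrecPred fun z => x z = 0 := Primrec.eq.comp hx (Primrec.const 0)
  have h4 : PrimrecPred fun z => height (shortBound b (l z)) (l z) (δ z).1 ≤ i z :=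
    Primrec.nat_le.comp (hh (primrec_src.comp hδ)) hi
  exact (h1.or h2).and (h3.or h4)

theorem primrecPred_witness (b : ℕ) {γ : Type*} [Primcodable γ] {l e ρ : γ → List (Edge α R)}
    {p q : γ → ℕ} {t : γ → List ℕ} (hl : Primrec l) (hp : Primrec p) (hq : Primrec q)
    (he : Primrec e) (hρ : Primrec ρ) (ht : Primrec t) :
    PrimrecPred fun z => Witness b (l z) (p z) (q z) (e z) (ρ z, t z) := by
  have htD : Primrec₂ fun (z : γ) (i : ℕ) => (t z).getD i 0 :=
    (Primrec.list_getD 0).comp (ht.comp Primrec.fst) Primrec.snd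
  have heD : Primrec₂ fun (z : γ) (i : ℕ) => (e z)[i]? :=
    Primrec.list_getElem?.comp (he.comp Primrec.fst) Primrec.snd
  have h1 : PrimrecPred fun z => ρ z ≠ [] := (Primrec.eq.comp hρ (Primrec.const [])).not
  have h2 : PrimrecPred fun z => pathEnd (p z) (ρ z) = some (q z) :=
    Primrec.eq.comp (primrec_pathEnd.comp hp hρ) (Primrec.option_some.comp hq)
  have h3 : PrimrecPred fun z => ∀ i < (e z).length, (ρ z)[(t z).getD i 0]? = (e z)[i]? := by
    refine primrecPred_forall_lt (Primrec.list_length.comp he) ?_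
    exact Primrec.eq.comp (Primrec.list_getElem?.comp (hρ.comp Primrec.fst) htD) heD
  have h4 : PrimrecPred fun z => ∀ i < (l z).length, ∀ δ ∈ e z, (e z)[i]? = some δ →
      Canon (height (shortBound b (l z)) (l z)) (ρ z).length i ((t z).getD i 0) δ := by
    refine primrecPred_forall_lt (Primrec.list_length.comp hl) ?_
    refine primrecPred_forall_mem (he.comp Primrec.fst) ?_
    have hz : Primrec fun w : (γ × ℕ) × Edge α R => w.1.1 := Primrec.fst.comp Primrec.fst
    have hi : Primrec fun w : (γ × ℕ) × Edge α R => w.1.2 := Primrec.snd.comp Primrec.fst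
    exact PrimrecPred.imp (Primrec.eq.comp (heD.comp hz hi) (Primrec.option_some.comp Primrec.snd))
      (primrecPred_canon b (hl.comp hz) (Primrec.list_length.comp (hρ.comp hz)) hi
        (htD.comp hz hi) Primrec.snd)
  exact h1.and (h2.and (h3.and h4))

end Runs

/-! ### Gödel numbers -/

section Codes

/-- Gödel number of a conjunction. -/
def conjCode (L : List ℕ) : ℕ :=
  L.foldr (fun c d => Nat.pair 4 (Nat.pair c d)) (Nat.pair 0 0)

/-- Gödel number of a disjunction. -/
def disjCode (L : List ℕ) : ℕ := Nat.pair 3 (conjCode (L.map (Nat.pair 3)))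

/-- Gödel number of an existential quantification. -/
def exCode (x c : ℕ) : ℕ := Nat.pair 3 (Nat.pair 5 (Nat.pair x (Nat.pair 3 c)))

variable {α R : Type*}

theorem code_conj [Encodable α] (L : List (FO α)) :
    (FO.conj L).code = conjCode (L.map FO.code) := by
  induction L with
  | nil => rfl
  | cons φ L ih => simp [FO.conj, FO.code, ih, conjCode]

theorem code_disj [Encodable α] (L : List (FO α)) :
    (FO.disj L).code = disjCode (L.map FO.code) := by
  simp [FO.disj, FO.code, code_conj, disjCode, Function.comp_def]

theorem code_sumList [Encodable α] [Encodable R] (L : List (WFO α R)) :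
    (WFO.sumList L).code =
      (L.map WFO.code).foldr (fun c d => Nat.pair 3 (Nat.pair c d)) (Nat.pair 0 0) := by
  induction L with
  | nil => rfl
  | cons Φ L ih => simp [WFO.sumList, WFO.code, ih]

theorem primrec_foldr_pair (k : ℕ) : Primrec fun L : List ℕ =>
    L.foldr (fun c d => Nat.pair k (Nat.pair c d)) (Nat.pair 0 0) :=
  Primrec.list_foldr (h := fun _ z => Nat.pair k (Nat.pair z.1 z.2)) Primrec.id
    (Primrec.const _) (Primrec₂.natPair.comp (Primrec.const k)
      (Primrec₂.natPair.comp (Primrec.fst.comp Primrec.snd) (Primrec.snd.comp Primrec.snd)))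

theorem primrec_conjCode : Primrec conjCode := primrec_foldr_pair 4

theorem primrec_pair_const (k : ℕ) : Primrec (Nat.pair k) :=
  Primrec₂.natPair.comp (Primrec.const k) Primrec.id

theorem primrec_disjCode : Primrec disjCode :=
  (primrec_pair_const 3).comp (primrec_conjCode.comp
    (Primrec.list_map Primrec.id ((primrec_pair_const 3).comp Primrec.snd)))

theorem primrec_exCode : Primrec₂ exCode :=
  (primrec_pair_const 3).comp ((primrec_pair_const 5).comp
    (Primrec₂.natPair.comp Primrec.fst ((primrec_pair_const 3).comp Primrec.snd)))

variable [Primcodable α] [Primcodable R] {γ β : Type*} [Primcodable γ] [Primcodable β]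

/-- Only codes are ever computed: the formulas themselves need no `Primcodable` structure, and the
hypothesis concerns the code of `φ z x`. -/
theorem primrec_code_conj_map {L : γ → List β} {φ : γ → β → FO α} (hL : Primrec L)
    (hφ : Primrec₂ fun z x => (φ z x).code) :
    Primrec fun z => (FO.conj ((L z).map (φ z))).code :=
  (primrec_conjCode.comp (Primrec.list_map hL hφ)).of_eq fun z => by
    rw [code_conj, List.map_map]; rfl

theorem primrec_code_disj_map {L : γ → List β} {φ : γ → β → FO α} (hL : Primrec L)
    (hφ : Primrec₂ fun z x => (φ z x).code) :
    Primrec fun z => (FO.disj ((L z).map (φ z))).code :=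
  (primrec_disjCode.comp (Primrec.list_map hL hφ)).of_eq fun z => by
    rw [code_disj, List.map_map]; rfl

theorem primrec_code_sumList_map {L : γ → List β} {Φ : γ → β → WFO α R} (hL : Primrec L)
    (hΦ : Primrec₂ fun z x => (Φ z x).code) :
    Primrec fun z => (WFO.sumList ((L z).map (Φ z))).code :=
  ((primrec_foldr_pair 3).comp (Primrec.list_map hL hΦ)).of_eq fun z => by
    rw [code_sumList, List.map_map]; rfl

theorem primrec_code_labelAt {w : γ → List α} {x i : γ → ℕ} (hw : Primrec w) (hx : Primrec x)
    (hi : Primrec i) : Primrec fun z => (FO.labelAt (w z) (x z) (i z)).code := by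
  have h : Primrec₂ fun (z : γ) (a : α) => (FO.letter a (i z)).code :=
    (primrec_pair_const 1).comp
      (Primrec₂.natPair.comp (Primrec.encode.comp Primrec.snd) (hi.comp Primrec.fst))
  refine (Primrec.option_casesOn (Primrec.list_getElem?.comp hw hx)
    (Primrec.const (FO.code (FO.top : FO α))) h).of_eq fun z => ?_
  unfold FO.labelAt
  cases (w z)[x z]? <;> rfl

theorem primrec_code_orderAt {x y i j : γ → ℕ} (hx : Primrec x) (hy : Primrec y)
    (hi : Primrec i) (hj : Primrec j) :
    Primrec fun z => (FO.orderAt (x z) (y z) (i z) (j z) : FO α).code := by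
  have h : Primrec fun z => (FO.le (i z) (j z) : FO α).code :=
    (primrec_pair_const 2).comp (Primrec₂.natPair.comp hi hj)
  refine (Primrec.ite (Primrec.nat_le.comp hx hy) h ((primrec_pair_const 3).comp h)).of_eq
    fun z => ?_
  unfold FO.orderAt
  split_ifs <;> rfl

theorem primrec_code_diagram {w : γ → List α} {t : γ → List ℕ} (hw : Primrec w)
    (ht : Primrec t) : Primrec fun z => (FO.diagram (w z) (t z)).code := by
  have hr : Primrec fun z => List.range (t z).length :=
    Primrec.list_range.comp (Primrec.list_length.comp ht)
  have hD : Primrec₂ fun z i => (t z).getD i 0 :=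
    (Primrec.list_getD 0).comp (ht.comp Primrec.fst) Primrec.snd
  have h1 : Primrec fun z => (FO.conj ((List.range (t z).length).map fun i =>
      FO.labelAt (w z) ((t z).getD i 0) i)).code :=
    primrec_code_conj_map hr (primrec_code_labelAt (hw.comp Primrec.fst) hD Primrec.snd)
  have hz : Primrec fun y : (γ × ℕ) × ℕ => y.1.1 := Primrec.fst.comp Primrec.fst
  have hi : Primrec fun y : (γ × ℕ) × ℕ => y.1.2 := Primrec.snd.comp Primrec.fst
  have h2 : Primrec fun z => (FO.conj ((List.range (t z).length).map fun i =>
      (FO.conj ((List.range (t z).length).map fun j =>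
        FO.orderAt ((t z).getD i 0) ((t z).getD j 0) i j) : FO α))).code :=
    primrec_code_conj_map hr (primrec_code_conj_map (hr.comp Primrec.fst)
      (primrec_code_orderAt (hD.comp hz hi) (hD.comp hz Primrec.snd) hi Primrec.snd))
  exact (primrec_pair_const 4).comp (Primrec₂.natPair.comp h1 h2)

/-- Gödel number of a Hintikka formula of positive rank, from the diagram and the Hintikka formulas
with one more position. -/
def hintikkaStep (c d : ℕ) (L : List ℕ) : ℕ :=
  Nat.pair 4 (Nat.pair c (Nat.pair 4 (Nat.pair (conjCode (L.map (exCode d)))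
    (Nat.pair 5 (Nat.pair d (disjCode L))))))

theorem code_hintikka_succ (w : List α) (k : ℕ) (t : List ℕ) :
    (FO.hintikka w (k + 1) t).code = hintikkaStep (FO.diagram w t).code t.length
      ((List.range w.length).map fun x => (FO.hintikka w k (t ++ [x])).code) := by
  simp only [FO.hintikka, FO.code, code_conj, code_disj, hintikkaStep, List.map_map]
  rfl

/-- A Hintikka formula calls those of all extensions of `t` by one position, with changed
parameters. This is recursion along a finite list of calls with the rank as decreasing measure, as
in `Primrec.nat_omega_rec'`. -/
theorem primrec_code_hintikka :
    Primrec fun z : List α × ℕ × List ℕ => (FO.hintikka z.1 z.2.1 z.2.2).code := by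
  have hw : Primrec fun z : List α × ℕ × List ℕ => z.1 := Primrec.fst
  have hk : Primrec fun z : List α × ℕ × List ℕ => z.2.1 := Primrec.fst.comp Primrec.snd
  have ht : Primrec fun z : List α × ℕ × List ℕ => z.2.2 := Primrec.snd.comp Primrec.snd
  have hdiag := primrec_code_diagram hw ht
  have hzero : PrimrecPred fun z : List α × ℕ × List ℕ => z.2.1 = 0 :=
    Primrec.eq.comp hk (Primrec.const 0)
  have hstep : Primrec₂ fun (z : List α × ℕ × List ℕ) (L : List ℕ) =>
      hintikkaStep (FO.diagram z.1 z.2.2).code z.2.2.length L := by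
    have hd : Primrec fun y : (List α × ℕ × List ℕ) × List ℕ => y.1.2.2.length :=
      Primrec.list_length.comp (ht.comp Primrec.fst)
    refine (primrec_pair_const 4).comp (Primrec₂.natPair.comp (hdiag.comp Primrec.fst)
      ((primrec_pair_const 4).comp (Primrec₂.natPair.comp (primrec_conjCode.comp ?_)
        ((primrec_pair_const 5).comp (Primrec₂.natPair.comp hd
          (primrec_disjCode.comp Primrec.snd))))))
    exact Primrec.list_map Primrec.snd (primrec_exCode.comp (hd.comp Primrec.fst) Primrec.snd)
  have hch : Primrec fun z : List α × ℕ × List ℕ => if z.2.1 = 0 then [] else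
      (List.range z.1.length).map fun x => (z.1, z.2.1 - 1, z.2.2 ++ [x]) := by
    refine Primrec.ite hzero (Primrec.const []) (Primrec.list_map
      (Primrec.list_range.comp (Primrec.list_length.comp hw)) ?_)
    exact (hw.comp Primrec.fst).pair ((Primrec.pred.comp (hk.comp Primrec.fst)).pair
      (Primrec.list_concat.comp (ht.comp Primrec.fst) Primrec.snd))
  refine Primrec.nat_omega_rec' _ (m := fun z => z.2.1) hk hch
    (g := fun z L => some (if z.2.1 = 0 then (FO.diagram z.1 z.2.2).code else
      hintikkaStep (FO.diagram z.1 z.2.2).code z.2.2.length L))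
    (Primrec.option_some.comp (Primrec.ite (hzero.comp Primrec.fst) (hdiag.comp Primrec.fst)
      hstep)) ?_ ?_
  · rintro ⟨w, k, t⟩ z' hz'
    dsimp only at hz' ⊢
    split_ifs at hz' with h
    · simp at hz'
    · obtain ⟨x, -, rfl⟩ := List.mem_map.1 hz'
      dsimp only
      omega
  · rintro ⟨w, k, t⟩
    cases k with
    | zero => rfl
    | succ k =>
      dsimp only
      rw [if_neg (Nat.succ_ne_zero k), if_neg (Nat.succ_ne_zero k), code_hintikka_succ,
        List.map_map]
      rfl

theorem primrec_code_hintikka_comp {w : γ → List α} {k : γ → ℕ} {t : γ → List ℕ}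
    (hw : Primrec w) (hk : Primrec k) (ht : Primrec t) :
    Primrec fun z => (FO.hintikka (w z) (k z) (t z)).code :=
  primrec_code_hintikka.comp (hw.pair (hk.pair ht))

theorem primrec_pointedSeqs (b : ℕ) : Primrec₂
    (pointedSeqs b : List (Edge α R) → ℕ → List (List (Edge α R) × List ℕ)) := by
  refine Primrec.list_flatMap
    (primrec_seqs.comp Primrec.fst ((primrec_shortBound b).comp Primrec.fst)) ?_
  refine Primrec.list_map (primrec_tuples.comp
    (Primrec.list_range.comp (Primrec.list_length.comp Primrec.snd))
    (Primrec.snd.comp Primrec.fst)) ?_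
  exact (Primrec.snd.comp Primrec.fst).pair Primrec.snd

theorem primrec_code_runFormula (b : ℕ) {l e : γ → List (Edge α R)} {p q : γ → ℕ}
    (hl : Primrec l) (hp : Primrec p) (hq : Primrec q) (he : Primrec e) :
    Primrec fun z => (runFormula b (l z) (p z) (q z) (e z)).code := by
  classical
  have hwit : PrimrecRel fun (z : γ) (x : List (Edge α R) × List ℕ) =>
      Witness b (l z) (p z) (q z) (e z) x :=
    primrecPred_witness b (hl.comp Primrec.fst) (hp.comp Primrec.fst) (hq.comp Primrec.fst)
      (he.comp Primrec.fst) (Primrec.fst.comp Primrec.snd) (Primrec.snd.comp Primrec.snd)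
  have hf : Primrec fun z => (pointedSeqs b (l z) (e z).length).filter fun x =>
      Witness b (l z) (p z) (q z) (e z) x :=
    primrec_filter ((primrec_pointedSeqs b).comp hl (Primrec.list_length.comp he)) hwit
  refine (primrec_code_disj_map hf (φ := fun z x =>
    FO.hintikka (x.1.map fun δ => δ.2.1) (runRank (l z)) x.2) ?_).of_eq fun z => ?_
  · have hw : Primrec fun y : γ × List (Edge α R) × List ℕ => y.2.1.map fun δ => δ.2.1 :=
      Primrec.list_map (Primrec.fst.comp Primrec.snd) (primrec_lab.comp Primrec.snd)
    have hk : Primrec fun y : γ × List (Edge α R) × List ℕ => runRank (l y.1) :=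
      primrec_runRank.comp (hl.comp Primrec.fst)
    exact primrec_code_hintikka_comp hw hk (Primrec.snd.comp Primrec.snd)
  · unfold runFormula
    congr!

theorem primrec_code_weightFormula (b : ℕ) {l e : γ → List (Edge α R)} {p q : γ → ℕ} {r : γ → R}
    (hl : Primrec l) (hp : Primrec p) (hq : Primrec q) (he : Primrec e) (hr : Primrec r) :
    Primrec fun z => (weightFormula b (l z) (p z) (q z) (e z) (r z)).code := by
  have hstep : Primrec₂ fun (z : γ) (y : Edge α R × ℕ) => Nat.pair 1 (Nat.pair
      (runFormula b (l z) (p z) (q z) (e z ++ [y.1])).code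
      (Nat.pair (Nat.pair 0 (Encodable.encode y.1.2.2.2)) y.2)) := by
    have hδ : Primrec fun y : γ × Edge α R × ℕ => y.2.1 := Primrec.fst.comp Primrec.snd
    have h1 := primrec_code_runFormula b (hl.comp Primrec.fst) (hp.comp Primrec.fst)
      (hq.comp Primrec.fst) (Primrec.list_concat.comp (he.comp Primrec.fst) hδ)
    exact (primrec_pair_const 1).comp (Primrec₂.natPair.comp h1 (Primrec₂.natPair.comp
      ((primrec_pair_const 0).comp (Primrec.encode.comp (primrec_wt.comp hδ)))
      (Primrec.snd.comp Primrec.snd)))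
  refine (Primrec.list_foldr hl ((primrec_pair_const 0).comp (Primrec.encode.comp hr))
    hstep).of_eq fun z => ?_
  unfold weightFormula
  generalize l z = l'
  have key : ∀ L : List (Edge α R), L.foldr (fun δ c => Nat.pair 1 (Nat.pair
      (runFormula b l' (p z) (q z) (e z ++ [δ])).code
      (Nat.pair (Nat.pair 0 (Encodable.encode δ.2.2.2)) c))) (Nat.pair 0 (Encodable.encode (r z))) =
      (L.foldr (fun δ Ψ => StepFO.ite (runFormula b l' (p z) (q z) (e z ++ [δ]))
        (StepFO.const δ.2.2.2) Ψ) (StepFO.const (r z))).code := by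
    intro L
    induction L with
    | nil => rfl
    | cons δ L ih => simp only [List.foldr_cons, ih, StepFO.code]
  exact key l'

theorem primrec_code_sumVars {j : γ → ℕ} {Φ : γ → WFO α R} (hj : Primrec j)
    (hΦ : Primrec fun z => (Φ z).code) : Primrec fun z => (WFO.sumVars (j z) (Φ z)).code := by
  have key : ∀ (j : ℕ) (Φ : WFO α R), (WFO.sumVars j Φ).code =
      (List.range j).foldr (fun i c => Nat.pair 4 (Nat.pair i c)) Φ.code := by
    intro j
    induction j with
    | zero => intro Φ; rfl
    | succ j ih => intro Φ; rw [WFO.sumVars, ih, List.range_succ, List.foldr_append]; rfl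
  refine (Primrec.list_foldr (Primrec.list_range.comp hj) hΦ
    (h := fun _ y => Nat.pair 4 (Nat.pair y.1 y.2)) ?_).of_eq fun z => (key _ _).symm
  exact (primrec_pair_const 4).comp (Primrec₂.natPair.comp (Primrec.fst.comp Primrec.snd)
    (Primrec.snd.comp Primrec.snd))

theorem primrec_code_matchFormula (b : ℕ) {l e : γ → List (Edge α R)} {p q : γ → ℕ} {r : γ → R}
    (hl : Primrec l) (hp : Primrec p) (hq : Primrec q) (he : Primrec e) (hr : Primrec r) :
    Primrec fun z => (matchFormula b (l z) (p z) (q z) (e z) (r z)).code := by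
  have hlen : Primrec fun z => (l z).length := Primrec.list_length.comp hl
  refine primrec_code_sumVars hlen ?_
  exact (primrec_pair_const 2).comp (Primrec₂.natPair.comp (primrec_code_runFormula b hl hp hq he)
    (Primrec₂.natPair.comp ((primrec_pair_const 1).comp (Primrec₂.natPair.comp hlen
      (primrec_code_weightFormula b hl hp hq he hr))) (Primrec.const (Nat.pair 0 0))))

theorem primrec_code_pairFormula (b : ℕ) {l : γ → List (Edge α R)} {p q : γ → ℕ}
    (hl : Primrec l) (hp : Primrec p) (hq : Primrec q) :
    Primrec fun z => (pairFormula b (l z) (p z) (q z)).code := by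
  have h : Primrec₂ fun (z : γ) (d : Edge α R) => (WFO.sumList ((tuples (l z) (l z).length).map
      fun e => matchFormula b (l z) (p z) (q z) e d.2.2.2)).code := by
    refine primrec_code_sumList_map (primrec_tuples.comp (hl.comp Primrec.fst)
      (Primrec.list_length.comp (hl.comp Primrec.fst))) ?_
    have hz : Primrec fun y : (γ × Edge α R) × List (Edge α R) => y.1.1 :=
      Primrec.fst.comp Primrec.fst
    exact primrec_code_matchFormula b (hl.comp hz) (hp.comp hz) (hq.comp hz) Primrec.snd
      (primrec_wt.comp (Primrec.snd.comp Primrec.fst))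
  refine (Primrec.option_casesOn (Primrec.list_head?.comp hl)
    (Primrec.const (WFO.code (WFO.zero : WFO α R))) h).of_eq fun z => ?_
  unfold pairFormula
  cases (l z).head? <;> rfl

theorem primrec_code_pairSentence (b : ℕ) {l : γ → List (Edge α R)} {p q : γ → ℕ}
    (hl : Primrec l) (hp : Primrec p) (hq : Primrec q) :
    Primrec fun z => (pairSentence b (l z) (p z) (q z)).code := by
  classical
  exact primrec_code_pairFormula b (primrec_dedup.comp hl) hp hq

theorem primrec_code_accSentence (b : ℕ) {l : γ → List (Edge α R)} {lI lF : γ → List ℕ}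
    (hl : Primrec l) (hI : Primrec lI) (hF : Primrec lF) :
    Primrec fun z => (accSentence b (l z) (lI z) (lF z)).code := by
  have hpairs : Primrec fun z => (lI z).dedup.flatMap fun p => (lF z).dedup.map fun q => (p, q) := by
    refine Primrec.list_flatMap (primrec_dedup.comp hI) ?_
    refine Primrec.list_map (primrec_dedup.comp (hF.comp Primrec.fst)) ?_
    exact (Primrec.snd.comp Primrec.fst).pair Primrec.snd
  refine (primrec_code_sumList_map hpairs (Φ := fun z y => pairSentence b (l z) y.1 y.2)
    (primrec_code_pairSentence b (hl.comp Primrec.fst) (Primrec.fst.comp Primrec.snd)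
      (Primrec.snd.comp Primrec.snd))).of_eq fun z => ?_
  rw [accSentence, List.map_flatMap]
  simp only [List.map_map, Function.comp_def]

end Codes

end WFOAut

open WFOAut in
/-- Aperiodic SCC-unambiguous weighted automata have equivalent weighted first-order sentences, for
each pair of states and for the whole automaton (first part, arbitrary weights). The sentences can
be computed from the automaton, given as a finite list of weighted transitions, whenever the
weights can be coded (second part): the partial recursive functions `f` and `g` are defined at
least on all the listings of such automata, and return Gödel numbers of the required sentences. -/
theorem theorem5p5 {α : Type*} [Fintype α] {R : Type*} :
    (∀ (Q : Type*) [Fintype Q] (A : WAut α R Q), A.Aperiodic → A.SCCUnambiguous →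
      (∀ p q : Q, ∃ Φ : WFO α R, Φ.IsSentence ∧ A.usem p q = Φ.usem) ∧
      (∀ I F : Finset Q, ∃ Φ : WFO α R, Φ.IsSentence ∧ A.usemAcc I F = Φ.usem)) ∧
    (∀ [Primcodable α] [Primcodable R],
      (∃ f : List (ℕ × α × ℕ × R) × ℕ × ℕ →. ℕ, Partrec f ∧
        ∀ (n : ℕ) (A : WAut α R (Fin n)), A.Aperiodic → A.SCCUnambiguous →
          ∀ l : List (ℕ × α × ℕ × R), A.ListedBy l → ∀ p q : Fin n,
            ∃ Φ : WFO α R, Φ.code ∈ f (l, (p : ℕ), (q : ℕ)) ∧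
              Φ.IsSentence ∧ A.usem p q = Φ.usem) ∧
      (∃ g : List (ℕ × α × ℕ × R) × List ℕ × List ℕ →. ℕ, Partrec g ∧
        ∀ (n : ℕ) (A : WAut α R (Fin n)), A.Aperiodic → A.SCCUnambiguous →
          ∀ l : List (ℕ × α × ℕ × R), A.ListedBy l → ∀ lI lF : List (Fin n),
            ∃ Φ : WFO α R, Φ.code ∈ g (l, lI.map Fin.val, lF.map Fin.val) ∧
              Φ.IsSentence ∧ A.usemAcc lI.toFinset lF.toFinset = Φ.usem)) := by
  refine ⟨fun Q _ A hA hU => ?_, ?_⟩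
  · classical
    -- For mere existence any numbering of the states and any listing of the transitions will do.
    let ι : Q → ℕ := fun p => (Fintype.equivFin Q p).1
    have hι : Function.Injective ι := Fin.val_injective.comp (Fintype.equivFin Q).injective
    let l : List (Edge α R) := A.trans.attach.toList.map (edgeOf A ι)
    have hL : Listing A ι l := by
      intro x a y r
      simp only [l, List.mem_map, Finset.mem_toList, Finset.mem_attach, true_and]
      constructor
      · rintro ⟨⟨⟨p, a', q⟩, h⟩, heq⟩
        simp only [edgeOf, Prod.mk.injEq] at heq
        obtain ⟨rfl, rfl, rfl, rfl⟩ := heq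
        exact ⟨p, q, h, rfl, rfl, rfl⟩
      · rintro ⟨p, q, h, rfl, rfl, rfl⟩
        exact ⟨⟨(p, a, q), h⟩, rfl⟩
    refine ⟨fun p q => ⟨_, isSentence_pairSentence _ _ _ _, hL.usem_eq hι hA hU p q⟩,
      fun I F => ⟨accSentence (Fintype.card α) l (I.toList.map ι) (F.toList.map ι),
        isSentence_accSentence _ _ _ _, ?_⟩⟩
    have := hL.usemAcc_eq hι hA hU I.toList F.toList
    rwa [Finset.toList_toFinset, Finset.toList_toFinset] at this
  · intro _ _
    constructor
    -- The function is total and even primitive recursive; the hypotheses on the automaton only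
    -- matter for the correctness of its output.
    · refine ⟨fun z => Part.some (pairSentence (Fintype.card α) z.1 z.2.1 z.2.2).code,
        (primrec_code_pairSentence (R := R) _ Primrec.fst (Primrec.fst.comp Primrec.snd)
          (Primrec.snd.comp Primrec.snd)).to_comp.partrec, ?_⟩
      intro n A hA hU l hl p q
      exact ⟨_, Part.mem_some _, isSentence_pairSentence _ _ _ _,
        Listing.usem_eq (ι := Fin.val) Fin.val_injective hl hA hU p q⟩
    · refine ⟨fun z => Part.some (accSentence (Fintype.card α) z.1 z.2.1 z.2.2).code,
        (primrec_code_accSentence (R := R) _ Primrec.fst (Primrec.fst.comp Primrec.snd)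
          (Primrec.snd.comp Primrec.snd)).to_comp.partrec, ?_⟩
      intro n A hA hU l hl lI lF
      exact ⟨_, Part.mem_some _, isSentence_accSentence _ _ _ _,
        Listing.usemAcc_eq (ι := Fin.val) Fin.val_injective hl hA hU lI lF⟩
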